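/- Let $n$ be a positive integer, let $dV$ be Lebesgue measure on $\mathbb{C}^n$ normalized so that $\int_{\mathbb{C}^n} e^{-|z|^2}\,dV(z)=1$, and for $\alpha\in\mathbb{R}$ put $dV_\alpha(z)=(1+|z|)^{-\alpha}\,dV(z)$. For $0<p<\infty$ let $L^p_\alpha$ be the space of Lebesgue measurable $\psi:\mathbb{C}^n\to\mathbb{C}$ for which $$\|\psi\|_{L^p_\alpha}=\Big\{\int_{\mathbb{C}^n}\big|\psi(z)e^{-|z|^2/2}\big|^p\,dV_\alpha(z)\Big\}^{1/p}$$ is finite, and let $L^\infty_\alpha$ be the space of those for which $\|\psi\|_{L^\infty_\alpha}=\operatorname{ess\,sup}_{z}\,|\psi(z)|e^{-|z|^2/2}(1+|z|)^{-\alpha}$ is finite. Let $H(\mathbb{C}^n)$ be the space of entire functions on $\mathbb{C}^n$. For a positive integer $m$ and $f\in H(\mathbb{C}^n)$ with homogeneous expansion $f=\sum_{k\ge 0}f_k$ (where $f_k$ is a homogeneous polynomial of degree $k$), put $$\mathcal{R}^m f(z)=\frac{1}{(1+|z|)^m}\sum_{k=0}^\infty\frac{\Gamma(n+m+k)}{\Gamma(n+k)}f_k(z),\qquad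 \|f\|_{F^p_{\alpha,m}}=\|\mathcal{R}^m f\|_{L^p_\alpha},$$ and let $F^p_{\alpha,m}$ be the space of all $f\in H(\mathbb{C}^n)$ with $\mathcal{R}^m f\in L^p_\alpha$. For a multi-index $\gamma=(\gamma_1,\dots,\gamma_n)$ of nonnegative integers write $|\gamma|=\sum_j\gamma_j$ and $\partial^\gamma=\partial_1^{\gamma_1}\cdots\partial_n^{\gamma_n}$ with $\partial_j=\partial/\partial z_j$. **Corollary 4.4.** Given $0<p\le\infty$, a positive integer $m$ and $\alpha$ real, there is a constant $C=C(n,p,m,\alpha)>0$ such that $$C^{-1}\|f\|_{F^p_{\alpha,m}}\le\sum_{|\gamma|\le m}\|\partial^\gamma f\|_{L^p_\alpha}\le C\|f\|_{F^p_{\alpha,m}}$$ for all $f\in H(\mathbb{C}^n)$, where the quantities may take the value $+\infty$. Moreover, $F^p_{\alpha,m}$ is the space of all $f\in H(\mathbb{C}^n)$ such that $\partial^\gamma f\in L^p_\alpha$ for every multi-index $\gamma$ with $|\gamma|\le m$. -/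

import Mathlib

open MeasureTheory
open scoped ENNReal NNReal

noncomputable section

namespace FockSobolev

/-- Complex `n`-space with its Hermitian norm `|z| = (∑ |z_j|²)^{1/2}`. -/
abbrev CSpace (n : ℕ) : Type := EuclideanSpace ℂ (Fin n)

/-! ### Multi-indices and holomorphic partial derivatives -/

/-- `∂_j f = ∂f/∂z_j`. -/
def partialD {n : ℕ} (j : Fin n) (f : CSpace n → ℂ) : CSpace n → ℂ :=
  fun z => fderiv ℂ f z (EuclideanSpace.single j 1)

/-- `∂^γ f = ∂_1^{γ_1} ⋯ ∂_n^{γ_n} f`. -/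
def multiD {n : ℕ} (γ : Fin n → ℕ) (f : CSpace n → ℂ) : CSpace n → ℂ :=
  (List.finRange n).foldr (fun j g => (partialD j)^[γ j] g) f

/-- The finite set of multi-indices `γ` with `|γ| = k`. -/
def multiIndexEq (n k : ℕ) : Finset (Fin n → ℕ) :=
  (Fintype.piFinset fun _ : Fin n => Finset.range (k + 1)).filter fun γ => ∑ j, γ j = k

/-- The finite set of multi-indices `γ` with `|γ| ≤ m`. -/
def multiIndexLE (n m : ℕ) : Finset (Fin n → ℕ) :=
  (Fintype.piFinset fun _ : Fin n => Finset.range (m + 1)).filter fun γ => ∑ j, γ j ≤ m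

theorem mem_multiIndexEq {n k : ℕ} {γ : Fin n → ℕ} :
    γ ∈ multiIndexEq n k ↔ ∑ j, γ j = k := by
  simp only [multiIndexEq, Finset.mem_filter, Fintype.mem_piFinset, Finset.mem_range,
    and_iff_right_iff_imp]
  intro h j
  have := Finset.single_le_sum (f := γ) (fun i _ => Nat.zero_le _) (Finset.mem_univ j)
  omega

theorem mem_multiIndexLE {n m : ℕ} {γ : Fin n → ℕ} :
    γ ∈ multiIndexLE n m ↔ ∑ j, γ j ≤ m := by
  simp only [multiIndexLE, Finset.mem_filter, Fintype.mem_piFinset, Finset.mem_range,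
    and_iff_right_iff_imp]
  intro h j
  have := Finset.single_le_sum (f := γ) (fun i _ => Nat.zero_le _) (Finset.mem_univ j)
  omega

/-! ### Homogeneous expansion and fractional differentiation -/

/-- The term `f_k` of degree `k` in the homogeneous expansion `f = ∑ f_k` of an entire function:
`f_k(z) = ∑_{|ν| = k} (∂^ν f(0) / ν!) z^ν`. -/
def homogPart {n : ℕ} (f : CSpace n → ℂ) (k : ℕ) : CSpace n → ℂ :=
  fun z => ∑ ν ∈ multiIndexEq n k,
    multiD ν f 0 / ((∏ j, (ν j).factorial : ℕ) : ℂ) * ∏ j, z j ^ ν j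

/-- The Taylor polynomial `f_s^-` of `f`, of degree at most `|s|`. -/
def taylorHead {n : ℕ} (s : ℝ) (f : CSpace n → ℂ) : CSpace n → ℂ :=
  fun z => ∑ k ∈ Finset.range (⌊|s|⌋₊ + 1), homogPart f k z

/-- The fractional derivative `𝒟^s f`: the sum of `Γ(n+s+k) / Γ(n+k) • f_k` over all `k ≥ 0` if
`s ≥ 0`, and over all `k > |s|` if `s < 0`. -/
def fracD {n : ℕ} (s : ℝ) (f : CSpace n → ℂ) : CSpace n → ℂ :=
  fun z => ∑' k : ℕ,
    if 0 ≤ s ∨ |s| < (k : ℝ) then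
      ((Real.Gamma (n + s + k) / Real.Gamma (n + k) : ℝ) : ℂ) * homogPart f k z
    else 0

/-- The fractional radial derivative `ℛ^s f(z) = (1 + |z|)^{-s} 𝒟^s f(z)`. -/
def radialD {n : ℕ} (s : ℝ) (f : CSpace n → ℂ) : CSpace n → ℂ :=
  fun z => (((1 + ‖z‖) ^ (-s) : ℝ) : ℂ) * fracD s f z

/-! ### The weighted Lebesgue spaces `L^p_α` -/

/-- The volume measure `dV` on `ℂⁿ`, normalized so that `∫ e^{-|z|²} dV = 1`. -/
def volV (n : ℕ) : Measure (CSpace n) :=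
  ENNReal.ofReal ((Real.pi ^ n)⁻¹) • volume

theorem integral_exp_neg_norm_sq_volV (n : ℕ) :
    ∫ z, Real.exp (-‖z‖ ^ 2) ∂(volV n) = 1 := by
  have h := GaussianFourier.integral_rexp_neg_mul_sq_norm (V := CSpace n) (b := 1) one_pos
  have hr : Module.finrank ℝ (CSpace n) = 2 * n := by
    rw [← Module.finrank_mul_finrank ℝ ℂ (CSpace n)]
    simp [Complex.finrank_real_complex]
  have hc : (((2 * n : ℕ) : ℝ) / 2) = n := by push_cast; ring
  rw [hr, hc, div_one, Real.rpow_natCast] at h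
  have hpos : (0 : ℝ) < Real.pi ^ n := by positivity
  simp only [neg_mul, one_mul] at h
  rw [volV, integral_smul_measure, h, ENNReal.toReal_ofReal (by positivity), smul_eq_mul,
    inv_mul_cancel₀ hpos.ne']

/-- `dV_α(z) = dV(z) / (1 + |z|)^α`. -/
def volW (n : ℕ) (α : ℝ) : Measure (CSpace n) :=
  (volV n).withDensity fun z => ENNReal.ofReal (1 / (1 + ‖z‖) ^ α)

/-- The `L^p_α` "norm", with values in `[0, ∞]`: for `0 < p < ∞` it is
`(∫ |ψ(z) e^{-|z|²/2}|^p dV_α(z))^{1/p}`, and for `p = ∞` it is the essential supremum of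
`|ψ(z)| e^{-|z|²/2} / (1 + |z|)^α`. -/
def weightedNorm {n : ℕ} (p : ℝ≥0∞) (α : ℝ) (ψ : CSpace n → ℂ) : ℝ≥0∞ :=
  if p = ∞ then
    essSup (fun z => ENNReal.ofReal (‖ψ z‖ * Real.exp (-‖z‖ ^ 2 / 2) / (1 + ‖z‖) ^ α)) (volV n)
  else
    (∫⁻ z, ENNReal.ofReal (‖ψ z‖ * Real.exp (-‖z‖ ^ 2 / 2)) ^ p.toReal ∂(volW n α))
      ^ (1 / p.toReal)

/-- `ψ ∈ L^p_α`: `ψ` is Lebesgue measurable and its norm is finite. -/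
def MemL {n : ℕ} (p : ℝ≥0∞) (α : ℝ) (ψ : CSpace n → ℂ) : Prop :=
  AEStronglyMeasurable ψ (volV n) ∧ weightedNorm p α ψ < ∞

/-! ### The weighted Fock-Sobolev spaces `F^p_{α,s}` -/

/-- The space `F^p_{α,s}` of all entire `f` on `ℂⁿ` with `ℛ^s f ∈ L^p_α`. -/
def fockSobolev (n : ℕ) (p : ℝ≥0∞) (α s : ℝ) : Set (CSpace n → ℂ) :=
  {f | Differentiable ℂ f ∧ MemL p α (radialD s f)}

/-- The norm of `F^p_{α,s}`, with values in `[0, ∞]`. -/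
def fockSobolevNorm {n : ℕ} (p : ℝ≥0∞) (α s : ℝ) (f : CSpace n → ℂ) : ℝ≥0∞ :=
  if 0 ≤ s then weightedNorm p α (radialD s f)
  else weightedNorm p α (radialD s f) + weightedNorm p α (taylorHead s f)

end FockSobolev

end
/-! Let `R` be the Euler operator `f ↦ Df(z) z`. It multiplies `f_k` by `k`, so
`(1 + |z|)^m ℛ^m f = (R + n) (R + n + 1) ⋯ (R + n + m - 1) f`. Expanding `R` in partial derivatives
costs one factor `|z|` for each derivative, which bounds `ℛ^m f` pointwise by the `∂^γ f`.

Conversely, against the weight `e^{-|z|²/2} (1 + |z|)^s`, Cauchy's estimate at radius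
`(1 + |z|)⁻¹` trades a derivative for one power of `1 + |z|`, while
`f(z) = ∫₀¹ t^{a-1} ((R + a) f)(t z) dt` shows that inverting `R + a` gains two powers, because the
Gaussian decays like `e^{-(1 - t)|z|²/2}` along the ray. The `2m` powers gained pay for the factor
`(1 + |z|)^{-m}` and for up to `m` derivatives. Both estimates are local up to a rapidly decreasing
error, and the sub-mean value property of `|f|^p` turns them into `L^p` bounds for every `p > 0`. -/

open Complex Filter Metric Set Topology

noncomputable section

namespace FockSobolev

/-! ### Entire functions on a complex normed space -/

section Entire

variable {E F : Type*} [NormedAddCommGroup E] [NormedSpace ℂ E] [NormedAddCommGroup F]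
  [NormedSpace ℂ F] {f : E → F}

theorem hasDerivAt_comp_line (hf : Differentiable ℂ f) (x v : E) (t : ℂ) :
    HasDerivAt (fun t : ℂ => f (x + t • v)) (fderiv ℂ f (x + t • v) v) t := by
  have hline : HasDerivAt (fun t : ℂ => x + t • v) v t := by
    simpa using ((hasDerivAt_id t).smul_const v).const_add x
  exact (hf (x + t • v)).hasFDerivAt.comp_hasDerivAt t hline

theorem differentiable_comp_line (hf : Differentiable ℂ f) (x v : E) :
    Differentiable ℂ fun t : ℂ => f (x + t • v) :=
  fun t => (hasDerivAt_comp_line hf x v t).differentiableAt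

theorem norm_fderiv_le_div (hf : Differentiable ℂ f) {z : E} {r B : ℝ} (hr : 0 < r)
    (hB : ∀ y ∈ closedBall z r, ‖f y‖ ≤ B) : ‖fderiv ℂ f z‖ ≤ B / r := by
  have hB₀ : 0 ≤ B := (norm_nonneg _).trans (hB z (mem_closedBall_self hr.le))
  refine ContinuousLinearMap.opNorm_le_of_unit_norm (𝕜 := ℂ) (by positivity) fun v hv => ?_
  have h := norm_deriv_le_of_forall_mem_sphere_norm_le (c := 0) (C := B) hr
    (differentiable_comp_line hf z v).diffContOnCl fun t ht => hB _ (by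
      simpa [norm_smul, hv] using (mem_sphere_zero_iff_norm.1 ht).le)
  rw [(hasDerivAt_comp_line hf z v 0).deriv] at h
  simpa using h

variable [FiniteDimensional ℂ E]

theorem continuous_fderiv (hf : Differentiable ℂ f) : Continuous (fderiv ℂ f) := by
  have := FiniteDimensional.proper ℂ E
  refine continuous_iff.2 fun z₀ ε hε => ?_
  obtain ⟨δ, hδ, hfδ⟩ := uniformContinuousOn_iff.1
    ((isCompact_closedBall z₀ 2).uniformContinuousOn_of_continuous hf.continuous.continuousOn)
    (ε / 2) (half_pos hε)
  refine ⟨min δ 1, by positivity, fun z hz => ?_⟩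
  rw [lt_min_iff, dist_eq_norm] at hz
  have hshift : Differentiable ℂ fun w => f (w + (z - z₀)) := hf.comp (by fun_prop)
  have hdiff : fderiv ℂ (fun w => f (w + (z - z₀)) - f w) z₀ = fderiv ℂ f z - fderiv ℂ f z₀ := by
    rw [fderiv_fun_sub (hshift z₀) (hf z₀), fderiv_comp_add_right, add_sub_cancel]
  rw [dist_eq_norm, ← hdiff]
  refine lt_of_le_of_lt (norm_fderiv_le_div (hshift.sub hf) one_pos fun w hw => ?_)
    (div_one (ε / 2) ▸ half_lt_self hε)
  rw [mem_closedBall, dist_eq_norm] at hw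
  rw [Pi.sub_apply, ← dist_eq_norm]
  refine (hfδ _ ?_ _ ?_ (by simpa using hz.1)).le
  · rw [mem_closedBall, dist_eq_norm, add_sub_right_comm]
    linarith [norm_add_le (w - z₀) (z - z₀)]
  · rw [mem_closedBall, dist_eq_norm]
    linarith

theorem differentiable_intervalIntegral_smul_comp_add (hf : Differentiable ℂ f) {k : ℝ → ℂ}
    (hk : Continuous k) {γ : ℝ → E} (hγ : Continuous γ) (a b : ℝ) :
    Differentiable ℂ fun z => ∫ θ in a..b, k θ • f (z + γ θ) := by
  have := FiniteDimensional.proper ℂ E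
  intro z
  have hf' : Continuous fun q : E × ℝ => k q.2 • fderiv ℂ f (q.1 + γ q.2) :=
    (hk.comp continuous_snd).smul ((continuous_fderiv hf).comp (by fun_prop))
  have hfz (y : E) : Continuous fun θ => k θ • f (y + γ θ) :=
    hk.smul (hf.continuous.comp (by fun_prop))
  obtain ⟨B, hB⟩ := ((isCompact_closedBall z 1).prod (isCompact_uIcc (a := a)
    (b := b))).exists_bound_of_continuousOn hf'.continuousOn
  refine (intervalIntegral.hasFDerivAt_integral_of_dominated_of_fderiv_le
    (closedBall_mem_nhds z one_pos) (.of_forall fun y => (hfz y).aestronglyMeasurable)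
    ((hfz z).intervalIntegrable a b) (hf'.comp (.prodMk_right z)).aestronglyMeasurable
    (.of_forall fun θ hθ y hy => hB (y, θ) ⟨hy, uIoc_subset_uIcc hθ⟩)
    intervalIntegrable_const (.of_forall fun θ _ y _ => ?_)).differentiableAt
  exact ((hf _).hasFDerivAt.comp y ((hasFDerivAt_id y).add_const _)).fun_const_smul _

variable [CompleteSpace F]

theorem differentiable_fderiv_apply (hf : Differentiable ℂ f) (v : E) :
    Differentiable ℂ fun z => fderiv ℂ f z v := by
  have hcauchy : (fun z => fderiv ℂ f z v) = fun z => (2 * Real.pi * I : ℂ)⁻¹ •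
      ∫ θ in (0 : ℝ)..2 * Real.pi,
        (I * (circleMap 0 1 θ)⁻¹) • f (z + circleMap 0 1 θ • v) := by
    ext z
    have h := cderiv_eq_deriv isOpen_univ (differentiable_comp_line hf z v).differentiableOn
      one_pos (subset_univ (closedBall (0 : ℂ) 1))
    rw [(hasDerivAt_comp_line hf z v 0).deriv] at h
    rw [cderiv, circleIntegral] at h
    simp only [zero_smul, add_zero, sub_zero, deriv_circleMap] at h
    rw [← h]
    congr 1
    refine intervalIntegral.integral_congr fun θ _ => ?_
    have hne : circleMap 0 1 θ ≠ 0 := circleMap_ne_center one_ne_zero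
    simp only [smul_smul]
    congr 1
    field_simp
  rw [hcauchy]
  refine (differentiable_intervalIntegral_smul_comp_add hf ?_ (by fun_prop) 0 _).const_smul _
  exact continuous_const.mul
    ((continuous_circleMap 0 1).inv₀ fun θ => circleMap_ne_center one_ne_zero)

theorem contDiff_of_differentiable (hf : Differentiable ℂ f) (k : ℕ) : ContDiff ℂ k f := by
  induction k generalizing f with
  | zero => exact contDiff_zero.2 hf.continuous
  | succ k ih =>
    exact contDiff_succ_iff_fderiv_apply.2
      ⟨hf, by simp, fun v => ih (differentiable_fderiv_apply hf v)⟩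

theorem differentiable_fderiv (hf : Differentiable ℂ f) : Differentiable ℂ (fderiv ℂ f) :=
  ((contDiff_of_differentiable hf 2).fderiv_right (m := 1) le_rfl).differentiable one_ne_zero

theorem fderiv_fderiv_apply_comm (hf : Differentiable ℂ f) (z v w : E) :
    fderiv ℂ (fun z => fderiv ℂ f z v) z w = fderiv ℂ (fun z => fderiv ℂ f z w) z v := by
  have happly (u : E) := fderiv_clm_apply (differentiable_fderiv hf z)
    (differentiableAt_const (c := u))
  simpa [happly] using
    ((contDiff_of_differentiable hf 2).contDiffAt.isSymmSndFDerivAt (by simp)).eq w v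

/-- The shifted Euler operator `R + a`, where `R f (z) = Df(z) z` is the radial derivative. -/
def eulerD (a : ℕ) (f : E → F) : E → F :=
  fun z => fderiv ℂ f z z + a • f z

/-- The product `(R + a) (R + a + 1) ⋯ (R + a + k - 1)` of shifted Euler operators. On `ℂⁿ`, for
`a = n`, it is the fractional derivative `𝒟^k`. -/
def eulerPochhammer (a : ℕ) : ℕ → (E → F) → E → F
  | 0, f => f
  | k + 1, f => eulerPochhammer a k (eulerD (a + k) f)

theorem differentiable_eulerD (hf : Differentiable ℂ f) (a : ℕ) :
    Differentiable ℂ (eulerD a f) :=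
  ((differentiable_fderiv hf).clm_apply differentiable_id).add (hf.const_smul a)

theorem differentiable_eulerPochhammer (hf : Differentiable ℂ f) (a k : ℕ) :
    Differentiable ℂ (eulerPochhammer a k f) := by
  induction k generalizing f with
  | zero => exact hf
  | succ k ih => exact ih (differentiable_eulerD hf _)

theorem fderiv_eulerD_apply (hf : Differentiable ℂ f) (a : ℕ) (z v : E) :
    fderiv ℂ (eulerD a f) z v = eulerD (a + 1) (fun w => fderiv ℂ f w v) z := by
  have hf' := differentiable_fderiv hf
  have hEuler : HasFDerivAt (eulerD a f) _ z :=
    ((hf' z).hasFDerivAt.clm_apply (hasFDerivAt_id z)).add ((hf z).hasFDerivAt.const_smul a)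
  have hcomm : fderiv ℂ (fderiv ℂ f) z v z = fderiv ℂ (fun w => fderiv ℂ f w v) z z := by
    rw [← fderiv_fderiv_apply_comm hf z z v,
      fderiv_clm_apply (hf' z) (differentiableAt_const z)]
    simp
  rw [hEuler.fderiv, eulerD, ← hcomm]
  simp [add_smul]
  abel

end Entire

/-! ### Homogeneous expansions of entire functions on `ℂⁿ` -/

section MultiIndex

variable {n : ℕ} {f : CSpace n → ℂ}

theorem multiIndex_induction {P : (Fin n → ℕ) → Prop} (zero : P 0)
    (add_single : ∀ γ j, P γ → P (γ + Pi.single j 1)) (γ : Fin n → ℕ) : P γ := by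
  induction hk : ∑ j, γ j generalizing γ with
  | zero =>
    obtain rfl : γ = 0 := by simpa [funext_iff] using hk
    exact zero
  | succ k ih =>
    obtain ⟨j, -, hj⟩ := Finset.exists_ne_zero_of_sum_ne_zero (hk.trans_ne k.succ_ne_zero)
    have hγ : γ - Pi.single j 1 + Pi.single j 1 = γ :=
      tsub_add_cancel_of_le
        (update_le_iff.2 ⟨Nat.one_le_iff_ne_zero.2 hj, fun i _ => (γ i).zero_le⟩)
    rw [← hγ] at hk ⊢
    refine add_single _ j (ih _ ?_)
    simpa [Finset.sum_add_distrib] using hk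

theorem differentiable_partialD (hf : Differentiable ℂ f) (j : Fin n) :
    Differentiable ℂ (partialD j f) :=
  differentiable_fderiv_apply hf _

theorem partialD_comm (hf : Differentiable ℂ f) (i j : Fin n) :
    partialD i (partialD j f) = partialD j (partialD i f) :=
  funext fun z => fderiv_fderiv_apply_comm hf z _ _

theorem fderiv_eq_sum_partialD (f : CSpace n → ℂ) (z v : CSpace n) :
    fderiv ℂ f z v = ∑ j, v j * partialD j f z := by
  conv_lhs => rw [← (EuclideanSpace.basisFun (Fin n) ℂ).sum_repr v]
  simp [partialD]

theorem norm_partialD_le (f : CSpace n → ℂ) (j : Fin n) (z : CSpace n) :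
    ‖partialD j f z‖ ≤ ‖fderiv ℂ f z‖ :=
  (fderiv ℂ f z).unit_le_opNorm _ (by simp)

theorem differentiable_iterate_partialD (hf : Differentiable ℂ f) (j : Fin n) (k : ℕ) :
    Differentiable ℂ ((partialD j)^[k] f) := by
  induction k with
  | zero => exact hf
  | succ k ih => exact Function.iterate_succ_apply' (partialD j) k f ▸ differentiable_partialD ih j

theorem partialD_iterate_comm (hf : Differentiable ℂ f) (i j : Fin n) (k : ℕ) :
    partialD i ((partialD j)^[k] f) = (partialD j)^[k] (partialD i f) := by
  induction k with
  | zero => rfl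
  | succ k ih =>
    rw [Function.iterate_succ_apply', Function.iterate_succ_apply', ← ih,
      partialD_comm (differentiable_iterate_partialD hf j k)]

/-- The iterated partial derivative `∂^γ` restricted to the coordinates in the list `l`; it
interpolates between `f` and `multiD γ f` in inductions on `l`. -/
def listD (l : List (Fin n)) (γ : Fin n → ℕ) (f : CSpace n → ℂ) : CSpace n → ℂ :=
  l.foldr (fun j g => (partialD j)^[γ j] g) f

theorem differentiable_listD (hf : Differentiable ℂ f) (l : List (Fin n)) (γ : Fin n → ℕ) :
    Differentiable ℂ (listD l γ f) := by
  induction l with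
  | nil => exact hf
  | cons j l ih => exact differentiable_iterate_partialD ih j _

theorem listD_add_single_of_notMem {l : List (Fin n)} {i : Fin n} (hi : i ∉ l) (γ : Fin n → ℕ)
    (f : CSpace n → ℂ) : listD l (γ + Pi.single i 1) f = listD l γ f :=
  List.foldr_ext _ _ _ fun j hj g => by
    simp [Pi.single_eq_of_ne fun hji : j = i => hi (hji ▸ hj)]

theorem partialD_listD (hf : Differentiable ℂ f) {l : List (Fin n)} (hl : l.Nodup)
    (γ : Fin n → ℕ) {i : Fin n} (hi : i ∈ l) :
    partialD i (listD l γ f) = listD l (γ + Pi.single i 1) f := by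
  induction l with
  | nil => simp at hi
  | cons j l ih =>
    rw [List.nodup_cons] at hl
    have hcons (δ : Fin n → ℕ) : listD (j :: l) δ f = (partialD j)^[δ j] (listD l δ f) := rfl
    rw [hcons, hcons]
    rcases List.mem_cons.1 hi with rfl | hil
    · rw [listD_add_single_of_notMem hl.1, Pi.add_apply, Pi.single_eq_same,
        Function.iterate_succ_apply']
    · have hji : j ≠ i := fun h => hl.1 (h ▸ hil)
      rw [partialD_iterate_comm (differentiable_listD hf l γ), ih hl.2 hil, Pi.add_apply,
        Pi.single_eq_of_ne hji, add_zero]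

theorem multiD_zero (f : CSpace n → ℂ) : multiD (0 : Fin n → ℕ) f = f := by
  simp [multiD]

theorem partialD_multiD (hf : Differentiable ℂ f) (γ : Fin n → ℕ) (i : Fin n) :
    partialD i (multiD γ f) = multiD (γ + Pi.single i 1) f :=
  partialD_listD hf (List.nodup_finRange n) γ (List.mem_finRange i)

theorem differentiable_multiD (hf : Differentiable ℂ f) (γ : Fin n → ℕ) :
    Differentiable ℂ (multiD γ f) :=
  differentiable_listD hf _ γ

theorem multiD_eulerD (hf : Differentiable ℂ f) (a : ℕ) (γ : Fin n → ℕ) :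
    multiD γ (eulerD a f) = eulerD (a + ∑ j, γ j) (multiD γ f) := by
  induction γ using multiIndex_induction with
  | zero => simp [multiD_zero]
  | add_single γ j ih =>
    rw [← partialD_multiD (differentiable_eulerD hf a), ← partialD_multiD hf, ih]
    ext z
    rw [partialD, fderiv_eulerD_apply (differentiable_multiD hf γ), add_assoc]
    simp only [Pi.add_apply, Finset.sum_add_distrib, Finset.sum_pi_single', Finset.mem_univ,
      if_true]
    rfl

/-- The constant-coefficient differential operator `P ↦ P(∂) f` with symbol `P`, as a linear
function of `P`. -/
def symbolD (f : CSpace n → ℂ) : MvPolynomial (Fin n) ℂ →ₗ[ℂ] CSpace n → ℂ :=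
  (MvPolynomial.basisMonomials (Fin n) ℂ).constr ℂ fun γ => multiD γ f

theorem symbolD_monomial (f : CSpace n → ℂ) (γ : Fin n →₀ ℕ) (c : ℂ) :
    symbolD f (MvPolynomial.monomial γ c) = c • multiD γ f := by
  have hbasis : symbolD f (MvPolynomial.monomial γ 1) = multiD γ f :=
    (MvPolynomial.basisMonomials (Fin n) ℂ).constr_basis ℂ _ γ
  rw [← hbasis, ← map_smul, MvPolynomial.smul_monomial, smul_eq_mul, mul_one]

theorem hasDerivAt_symbolD_comp_ray (hf : Differentiable ℂ f) (P : MvPolynomial (Fin n) ℂ)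
    (z : CSpace n) (t : ℂ) :
    HasDerivAt (fun t : ℂ => symbolD f P (t • z))
      (symbolD f ((∑ j, MvPolynomial.C (z j) * MvPolynomial.X j) * P) (t • z)) t := by
  induction P using MvPolynomial.induction_on' with
  | monomial γ c =>
    have h := (hasDerivAt_comp_line (differentiable_multiD hf γ) 0 z t).const_mul c
    simp only [zero_add] at h
    simp only [symbolD_monomial, Pi.smul_apply, smul_eq_mul]
    refine h.congr_deriv ?_
    rw [fderiv_eq_sum_partialD, Finset.sum_mul, map_sum, Finset.sum_apply, Finset.mul_sum]
    refine Finset.sum_congr rfl fun j _ => ?_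
    have hmul : MvPolynomial.C (z j) * MvPolynomial.X j * MvPolynomial.monomial γ c =
        MvPolynomial.monomial (γ + Finsupp.single j 1) (c * z j) := by
      rw [MvPolynomial.X, MvPolynomial.C_mul_monomial, MvPolynomial.monomial_mul]
      rw [mul_one, add_comm, mul_comm]
    rw [partialD_multiD hf, hmul, symbolD_monomial, Finsupp.coe_add, Finsupp.single_eq_pi_single]
    simp [mul_assoc]
  | add P Q hP hQ =>
    simp only [mul_add, map_add, Pi.add_apply]
    exact hP.add hQ

theorem iteratedDeriv_comp_ray (hf : Differentiable ℂ f) (z : CSpace n) (k : ℕ) :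
    iteratedDeriv k (fun t : ℂ => f (t • z)) = fun t =>
      symbolD f ((∑ j, MvPolynomial.C (z j) * MvPolynomial.X j) ^ k) (t • z) := by
  induction k with
  | zero =>
    have h1 : symbolD f 1 = f := by
      simpa [multiD_zero] using symbolD_monomial f 0 1
    simp [h1]
  | succ k ih =>
    rw [iteratedDeriv_succ, ih, pow_succ']
    exact funext fun t => (hasDerivAt_symbolD_comp_ray hf _ z t).deriv

theorem symbolD_sum_pow (f : CSpace n → ℂ) (z : CSpace n) (k : ℕ) :
    symbolD f ((∑ j, MvPolynomial.C (z j) * MvPolynomial.X j) ^ k) 0 =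
      k.factorial * homogPart f k z := by
  have hmem (ν : Fin n → ℕ) : ν ∈ Finset.univ.piAntidiag k ↔ ν ∈ multiIndexEq n k := by
    simp [mem_multiIndexEq]
  rw [Finset.sum_pow_eq_sum_piAntidiag, map_sum, Finset.sum_apply, homogPart, Finset.mul_sum]
  refine Finset.sum_congr (Finset.ext hmem) fun ν hν => ?_
  have hfact : (Nat.multinomial Finset.univ ν : ℂ) * ((∏ j, (ν j).factorial : ℕ) : ℂ) =
      k.factorial := by
    rw [← (mem_multiIndexEq.1 hν), ← Nat.cast_mul, mul_comm, Nat.multinomial_spec]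
  have hmonomial : (Nat.multinomial Finset.univ ν : MvPolynomial (Fin n) ℂ) *
      ∏ j, (MvPolynomial.C (z j) * MvPolynomial.X j) ^ ν j =
      MvPolynomial.monomial (Finsupp.equivFunOnFinite.symm ν)
        (Nat.multinomial Finset.univ ν * ∏ j, z j ^ ν j) := by
    rw [MvPolynomial.monomial_eq, Finsupp.prod_fintype _ _ fun _ => pow_zero _]
    simp [mul_pow, Finset.prod_mul_distrib, mul_assoc]
  have hne : ((∏ j, (ν j).factorial : ℕ) : ℂ) ≠ 0 :=
    Nat.cast_ne_zero.2 (Finset.prod_ne_zero_iff.2 fun j _ => Nat.factorial_ne_zero _)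
  rw [hmonomial, symbolD_monomial, ← hfact, Pi.smul_apply, smul_eq_mul,
    Finsupp.coe_equivFunOnFinite_symm]
  field_simp

theorem hasSum_homogPart (hf : Differentiable ℂ f) (z : CSpace n) :
    HasSum (fun k => homogPart f k z) (f z) := by
  have hray : Differentiable ℂ fun t : ℂ => f (t • z) := hf.comp (by fun_prop)
  have h := hasSum_taylorSeries_of_entire hray 0 1
  simp only [iteratedDeriv_comp_ray hf, zero_smul, symbolD_sum_pow, one_smul, sub_zero, one_pow,
    smul_eq_mul, one_mul] at h
  have hfact (k : ℕ) : (k.factorial : ℂ) ≠ 0 := Nat.cast_ne_zero.2 k.factorial_ne_zero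
  simpa only [inv_mul_cancel_left₀ (hfact _)] using h

theorem homogPart_eulerD (hf : Differentiable ℂ f) (a k : ℕ) (z : CSpace n) :
    homogPart (eulerD a f) k z = (a + k : ℕ) * homogPart f k z := by
  simp only [homogPart, Finset.mul_sum]
  refine Finset.sum_congr rfl fun ν hν => ?_
  have h0 : eulerD (a + k) (multiD ν f) 0 = (a + k : ℕ) * multiD ν f 0 := by simp [eulerD]
  rw [multiD_eulerD hf, mem_multiIndexEq.1 hν, h0]
  ring

theorem homogPart_eulerPochhammer (hf : Differentiable ℂ f) (a m k : ℕ) (z : CSpace n) :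
    homogPart (eulerPochhammer a m f) k z = ((a + k).ascFactorial m : ℕ) * homogPart f k z := by
  induction m generalizing f with
  | zero => simp [eulerPochhammer]
  | succ m ih =>
    rw [eulerPochhammer, ih (differentiable_eulerD hf _), homogPart_eulerD hf,
      Nat.ascFactorial_succ]
    push_cast
    ring

theorem gamma_div_gamma_eq_ascFactorial (hn : 0 < n) (m k : ℕ) :
    Real.Gamma (n + m + k) / Real.Gamma (n + k) = (n + k).ascFactorial m := by
  have hpole (j : ℕ) : ((n + k : ℕ) : ℂ) ≠ -j := fun h => by
    have hsum : n + k + j = 0 := by exact_mod_cast add_eq_zero_iff_eq_neg.2 h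
    omega
  have h := Complex.Gamma_add_nat_div_Gamma_eq (n := m) _ hpole
  rw [ascPochhammer_nat_eq_natCast_ascFactorial] at h
  apply ofReal_injective
  push_cast [← Complex.Gamma_ofReal] at h ⊢
  rw [← h, add_right_comm]

theorem fracD_natCast (hn : 0 < n) (m : ℕ) (hf : Differentiable ℂ f) :
    fracD (m : ℝ) f = eulerPochhammer n m f := by
  ext z
  rw [← (hasSum_homogPart (differentiable_eulerPochhammer hf n m) z).tsum_eq, fracD]
  refine tsum_congr fun k => ?_
  rw [if_pos (.inl m.cast_nonneg), homogPart_eulerPochhammer hf,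
    gamma_div_gamma_eq_ascFactorial hn, ofReal_natCast]

end MultiIndex

/-! ### The sub-mean value property -/

section SubMeanValue

theorem log_norm_le_circleAverage {g : ℂ → ℂ} (hg : Differentiable ℂ g) {c : ℂ} {R : ℝ}
    (hR : 0 < R) (hc : g c ≠ 0) :
    Real.log ‖g c‖ ≤ Real.circleAverage (fun ζ => Real.log ‖g ζ‖) c R := by
  have hga : AnalyticOnNhd ℂ g (closedBall c |R|) := fun ζ _ => hg.analyticAt ζ
  rw [hga.circleAverage_log_norm hR.ne' hc, le_add_iff_nonneg_left]
  refine finsum_nonneg fun u => ?_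
  by_cases hu : u ∈ closedBall c |R|
  · refine mul_nonneg (mod_cast MeromorphicOn.AnalyticOnNhd.divisor_nonneg hga u) ?_
    rcases eq_or_ne c u with rfl | hcu
    · simp
    · rw [mem_closedBall', dist_eq_norm, abs_of_pos hR] at hu
      exact Real.log_nonneg ((le_mul_inv_iff₀ (norm_sub_pos_iff.2 hcu)).2 (by rwa [one_mul]))
  · simp [Function.locallyFinsuppWithin.apply_eq_zero_of_notMem _ hu]

theorem norm_rpow_le_circleAverage {g : ℂ → ℂ} (hg : Differentiable ℂ g) (c : ℂ) {R q : ℝ}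
    (hR : 0 < R) (hq : 0 < q) :
    ‖g c‖ ^ q ≤ Real.circleAverage (fun ζ => ‖g ζ‖ ^ q) c R := by
  rcases eq_or_ne (g c) 0 with hc | hc
  · rw [hc, norm_zero, Real.zero_rpow hq.ne']
    exact Real.circleAverage_nonneg_of_nonneg fun ζ _ => by positivity
  have hlog : CircleIntegrable (fun ζ => Real.log ‖g ζ‖) c R :=
    MeromorphicOn.circleIntegrable_log_norm fun ζ _ => (hg.analyticAt ζ).meromorphicAt
  have hpow : CircleIntegrable (fun ζ => ‖g ζ‖ ^ q) c R :=
    ContinuousOn.circleIntegrable' (hg.continuous.norm.rpow_const fun _ => .inr hq.le).continuousOn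
  -- Off the zeros of `g` this is `‖g ζ‖ ^ q`; at the zeros `Real.log 0 = 0` makes it `1`.
  have hexp : (fun ζ => ‖g ζ‖ ^ q) =ᶠ[codiscreteWithin (sphere c |R|)]
      fun ζ => Real.exp (q * Real.log ‖g ζ‖) := by
    have hga : AnalyticOnNhd ℂ g univ := fun ζ _ => hg.analyticAt ζ
    filter_upwards [codiscreteWithin_mono (subset_univ _) (hga.preimage_zero_mem_codiscrete hc)]
      with ζ hζ
    rw [Real.rpow_def_of_pos (norm_pos_iff.2 hζ), mul_comm]
  rw [Real.circleAverage_congr_codiscreteWithin hexp hR.ne']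
  have htangent (ζ : ℂ) : ‖g c‖ ^ q * (1 - q * Real.log ‖g c‖) +
      ‖g c‖ ^ q * q * Real.log ‖g ζ‖ ≤ Real.exp (q * Real.log ‖g ζ‖) := by
    have h := Real.add_one_le_exp (q * Real.log ‖g ζ‖ - q * Real.log ‖g c‖)
    rw [Real.exp_sub, mul_comm q (Real.log ‖g c‖), ← Real.rpow_def_of_pos (norm_pos_iff.2 hc),
      le_div_iff₀' (by positivity)] at h
    linarith
  refine le_trans ?_ (Real.circleAverage_mono ((circleIntegrable_const _ c R).add
    (hlog.const_smul (a := ‖g c‖ ^ q * q))) (hpow.congr_codiscreteWithin hexp)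
    fun ζ _ => htangent ζ)
  have hadd := Real.circleAverage_add
    (circleIntegrable_const (‖g c‖ ^ q * (1 - q * Real.log ‖g c‖)) c R)
    (hlog.const_smul (a := ‖g c‖ ^ q * q))
  rw [Real.circleAverage_const, Real.circleAverage_smul, smul_eq_mul] at hadd
  refine (le_of_eq ?_).trans ((add_le_add_right (mul_le_mul_of_nonneg_left
    (log_norm_le_circleAverage hg hR hc) (by positivity)) _).trans hadd.ge)
  ring

variable {E : Type*} [NormedAddCommGroup E] [NormedSpace ℂ E]

theorem enorm_rpow_le_lintegral_circle {f : E → ℂ} (hf : Differentiable ℂ f) {q : ℝ}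
    (hq : 0 < q) (z u : E) : ENNReal.ofReal (2 * Real.pi) * ‖f z‖ₑ ^ q ≤
      ∫⁻ θ in Ioc 0 (2 * Real.pi), ‖f (z + circleMap 0 1 θ • u)‖ₑ ^ q := by
  have havg := norm_rpow_le_circleAverage (differentiable_comp_line hf z u) 0 one_pos hq
  have hcont : Continuous fun θ => ‖f (z + circleMap 0 1 θ • u)‖ ^ q :=
    ((hf.continuous.comp (by fun_prop)).norm).rpow_const fun _ => .inr hq.le
  rw [Real.circleAverage_def, smul_eq_mul, zero_smul, add_zero,
    inv_mul_eq_div, le_div_iff₀' Real.two_pi_pos,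
    intervalIntegral.integral_of_le Real.two_pi_pos.le] at havg
  have henorm (x : E) : ‖f x‖ₑ ^ q = ENNReal.ofReal (‖f x‖ ^ q) := by
    rw [← ofReal_norm, ENNReal.ofReal_rpow_of_nonneg (norm_nonneg _) hq.le]
  simp only [henorm]
  rw [← ENNReal.ofReal_mul Real.two_pi_pos.le, ← ofReal_integral_eq_lintegral_ofReal
    (hcont.integrableOn_Ioc) (.of_forall fun θ => by positivity)]
  exact ENNReal.ofReal_le_ofReal havg

variable [FiniteDimensional ℂ E] [MeasurableSpace E] [BorelSpace E]
  (μ : Measure E) [μ.IsAddHaarMeasure]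

theorem measurePreserving_unit_smul {c : ℂ} (hc : ‖c‖ = 1) :
    MeasurePreserving (fun z : E => c • z) μ μ := by
  have hc₀ : c ≠ 0 := norm_ne_zero_iff.1 (hc ▸ one_ne_zero)
  have := FiniteDimensional.proper ℂ E
  have hmap : (μ.map (c • ·)).IsAddHaarMeasure :=
    (ContinuousLinearEquiv.smulLeft (R₁ := ℂ) (Units.mk0 c hc₀) : E ≃L[ℂ] E).isAddHaarMeasure_map μ
  refine ⟨measurable_const_smul c, ?_⟩
  have hball : μ.map (c • ·) (ball 0 1) = μ (ball 0 1) := by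
    rw [Measure.map_apply (measurable_const_smul c) measurableSet_ball]
    congr 1
    ext z
    simp [norm_smul, hc]
  have hsmul := Measure.isAddLeftInvariant_eq_smul (μ.map (c • ·)) μ
  have hscalar : (Measure.addHaarScalarFactor (μ.map (c • ·)) μ : ℝ≥0∞) = 1 := by
    rw [hsmul, Measure.smul_apply, ENNReal.smul_def, smul_eq_mul] at hball
    exact (ENNReal.mul_eq_right (measure_ball_pos μ 0 one_pos).ne' measure_ball_lt_top.ne).1 hball
  rw [hsmul, ENNReal.coe_eq_one.1 hscalar, one_smul]

theorem setLIntegral_ball_add_unit_smul (g : E → ℝ≥0∞) (z : E) {c : ℂ} (hc : ‖c‖ = 1) (r : ℝ) :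
    ∫⁻ u in ball 0 r, g (z + c • u) ∂μ = ∫⁻ u in ball z r, g u ∂μ := by
  have hc₀ : c ≠ 0 := norm_ne_zero_iff.1 (hc ▸ one_ne_zero)
  have hpres : MeasurePreserving (fun u : E => z + c • u) μ μ :=
    (measurePreserving_add_left μ z).comp (measurePreserving_unit_smul μ hc)
  have hemb : MeasurableEmbedding (fun u : E => z + c • u) :=
    (measurableEmbedding_addLeft z).comp (measurableEmbedding_const_smul₀ hc₀)
  rw [← hpres.setLIntegral_comp_preimage_emb hemb g (ball z r)]
  congr 2
  ext u
  simp [norm_smul, hc]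

theorem enorm_rpow_mul_measure_ball_le {f : E → ℂ} (hf : Differentiable ℂ f) {q : ℝ}
    (hq : 0 < q) (z : E) (r : ℝ) :
    ‖f z‖ₑ ^ q * μ (ball z r) ≤ ∫⁻ u in ball z r, ‖f u‖ₑ ^ q ∂μ := by
  set c := ENNReal.ofReal (2 * Real.pi)
  have hc : c ≠ 0 := by simp [c, Real.pi_pos]
  have hcont : Continuous fun v : E × ℝ => ‖f (z + circleMap 0 1 v.2 • v.1)‖ₑ ^ q :=
    ENNReal.continuous_rpow_const.comp (hf.continuous.comp (by fun_prop)).enorm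
  refine (ENNReal.mul_le_mul_iff_right hc ENNReal.ofReal_ne_top).1 ?_
  calc c * (‖f z‖ₑ ^ q * μ (ball z r))
      = ∫⁻ _u in ball (0 : E) r, c * ‖f z‖ₑ ^ q ∂μ := by
        rw [setLIntegral_const, Measure.addHaar_ball_center μ z r, mul_assoc]
    _ ≤ ∫⁻ u in ball (0 : E) r, (∫⁻ θ in Ioc 0 (2 * Real.pi),
          ‖f (z + circleMap 0 1 θ • u)‖ₑ ^ q) ∂μ :=
        lintegral_mono fun u => enorm_rpow_le_lintegral_circle hf hq z u
    _ = ∫⁻ θ in Ioc 0 (2 * Real.pi), ∫⁻ u in ball (0 : E) r,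
          ‖f (z + circleMap 0 1 θ • u)‖ₑ ^ q ∂μ :=
        lintegral_lintegral_swap hcont.measurable.aemeasurable
    _ = ∫⁻ _θ in Ioc 0 (2 * Real.pi), ∫⁻ u in ball z r, ‖f u‖ₑ ^ q ∂μ :=
        lintegral_congr fun θ =>
          setLIntegral_ball_add_unit_smul μ (fun u => ‖f u‖ₑ ^ q) z (by simp) r
    _ = c * ∫⁻ u in ball z r, ‖f u‖ₑ ^ q ∂μ := by
        rw [setLIntegral_const, mul_comm]
        simp [c]

theorem enorm_mul_measure_ball_rpow_le_eLpNorm {f : E → ℂ} (hf : Differentiable ℂ f)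
    {p : ℝ≥0∞} (hp : p ≠ 0) (z : E) {r : ℝ} (hr : 0 < r) :
    ‖f z‖ₑ * μ (ball z r) ^ (1 / p.toReal) ≤ eLpNorm f p (μ.restrict (ball z r)) := by
  have hball : μ (ball z r) ≠ 0 := (measure_ball_pos μ z hr).ne'
  have := FiniteDimensional.proper ℂ E
  rcases eq_or_ne p ∞ with rfl | hp_top
  · have hmean := enorm_rpow_mul_measure_ball_le μ hf one_pos z r
    simp only [ENNReal.rpow_one] at hmean
    rw [ENNReal.toReal_top, div_zero, ENNReal.rpow_zero, mul_one,
      ← ENNReal.mul_le_mul_iff_left hball measure_ball_lt_top.ne]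
    calc ‖f z‖ₑ * μ (ball z r) ≤ ∫⁻ u in ball z r, ‖f u‖ₑ ∂μ := hmean
      _ ≤ ∫⁻ _u in ball z r, eLpNorm f ∞ (μ.restrict (ball z r)) ∂μ :=
        lintegral_mono_ae (by simpa only [eLpNorm_exponent_top] using enorm_ae_le_eLpNormEssSup _ _)
      _ = _ := setLIntegral_const _ _
  · have hq : 0 < p.toReal := ENNReal.toReal_pos hp hp_top
    rw [eLpNorm_eq_lintegral_rpow_enorm_toReal hp hp_top]
    calc ‖f z‖ₑ * μ (ball z r) ^ (1 / p.toReal)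
        = (‖f z‖ₑ ^ p.toReal * μ (ball z r)) ^ (1 / p.toReal) := by
          rw [ENNReal.mul_rpow_of_nonneg _ _ (by positivity), ← ENNReal.rpow_mul,
            mul_one_div_cancel hq.ne', ENNReal.rpow_one]
      _ ≤ _ := ENNReal.rpow_le_rpow (enorm_rpow_mul_measure_ball_le μ hf hq z r) (by positivity)

end SubMeanValue

/-! ### Gaussian weights -/

section GaussianWeight

theorem rpow_le_rpow_abs_mul_rpow {a b c : ℝ} (ha : 0 < a) (hb : 0 < b) (hab : a ≤ c * b)
    (hba : b ≤ c * a) (s : ℝ) : a ^ s ≤ c ^ |s| * b ^ s := by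
  have hc : 0 < c := pos_of_mul_pos_left (ha.trans_le hab) hb.le
  rcases le_total 0 s with hs | hs
  · rw [abs_of_nonneg hs, ← Real.mul_rpow hc.le hb.le]
    exact Real.rpow_le_rpow ha.le hab hs
  · rw [abs_of_nonpos hs, Real.rpow_neg hc.le, ← Real.inv_rpow hc.le,
      ← Real.mul_rpow (inv_nonneg.2 hc.le) hb.le]
    exact Real.rpow_le_rpow_of_nonpos (by positivity) ((inv_mul_le_iff₀ hc).2 hba) hs

variable {E V : Type*} [NormedAddCommGroup E] [NormedAddCommGroup V]

/-- The weight `exp (-‖z‖² / 2) (1 + ‖z‖) ^ s` of the Fock spaces. -/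
def gaussWeight (s : ℝ) (z : E) : ℝ :=
  Real.exp (-‖z‖ ^ 2 / 2) * (1 + ‖z‖) ^ s

/-- The modulus of `g` against the weight `gaussWeight s`; its `L^p` norms are the norms to be
compared. -/
def gaussMod (s : ℝ) (g : E → V) (z : E) : ℝ :=
  ‖g z‖ * gaussWeight s z

theorem gaussWeight_pos (s : ℝ) (z : E) : 0 < gaussWeight s z := by
  unfold gaussWeight
  positivity

theorem gaussMod_nonneg (s : ℝ) (g : E → V) (z : E) : 0 ≤ gaussMod s g z :=
  mul_nonneg (norm_nonneg _) (gaussWeight_pos s z).le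

theorem continuous_gaussMod (s : ℝ) {g : E → V} (hg : Continuous g) :
    Continuous (gaussMod s g) :=
  hg.norm.mul <| (by fun_prop : Continuous fun z : E => Real.exp (-‖z‖ ^ 2 / 2)).mul <|
    (by fun_prop : Continuous fun z : E => 1 + ‖z‖).rpow_const fun _ => .inl (by positivity)

theorem gaussWeight_add (s t : ℝ) (z : E) :
    gaussWeight (s + t) z = gaussWeight s z * (1 + ‖z‖) ^ t := by
  rw [gaussWeight, gaussWeight, Real.rpow_add (by positivity), mul_assoc]

theorem gaussMod_mono {s t : ℝ} (hst : s ≤ t) (g : E → V) (z : E) :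
    gaussMod s g z ≤ gaussMod t g z := by
  unfold gaussMod gaussWeight
  gcongr
  linarith [norm_nonneg z]

theorem gaussWeight_le_mul {z w : E} {c : ℝ} (hzw : 1 + ‖z‖ ≤ c * (1 + ‖w‖))
    (hwz : 1 + ‖w‖ ≤ c * (1 + ‖z‖)) (s : ℝ) :
    gaussWeight s z ≤ c ^ |s| * Real.exp ((‖w‖ ^ 2 - ‖z‖ ^ 2) / 2) * gaussWeight s w := by
  have hexp : Real.exp (-‖z‖ ^ 2 / 2) =
      Real.exp ((‖w‖ ^ 2 - ‖z‖ ^ 2) / 2) * Real.exp (-‖w‖ ^ 2 / 2) := by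
    rw [← Real.exp_add]
    ring_nf
  calc gaussWeight s z ≤ Real.exp (-‖z‖ ^ 2 / 2) * (c ^ |s| * (1 + ‖w‖) ^ s) := by
        unfold gaussWeight
        gcongr
        exact rpow_le_rpow_abs_mul_rpow (by positivity) (by positivity) hzw hwz s
    _ = _ := by
        rw [hexp, gaussWeight]
        ring

theorem gaussWeight_le_of_norm_sub_le_one {z w : E} (hzw : ‖z - w‖ ≤ 1) (s : ℝ) :
    gaussWeight s z ≤ 2 ^ |s| * Real.exp ((‖w‖ ^ 2 - ‖z‖ ^ 2) / 2) * gaussWeight s w := by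
  have hz := norm_le_norm_add_norm_sub w z
  have hw := norm_le_norm_add_norm_sub z w
  rw [norm_sub_rev] at hz
  exact gaussWeight_le_mul (by linarith [norm_nonneg w]) (by linarith [norm_nonneg z]) s

theorem exists_one_add_rpow_mul_exp_le (c : ℝ) :
    ∃ B, ∀ x : ℝ, 0 ≤ x → (1 + x) ^ c * Real.exp (-x / 2) ≤ B := by
  refine ⟨⌈c⌉₊.factorial * 2 ^ ⌈c⌉₊ * Real.exp (1 / 2), fun x hx => ?_⟩
  have hpow := Real.pow_div_factorial_le_exp ((1 + x) / 2) (by positivity) ⌈c⌉₊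
  rw [div_pow, div_div, div_le_iff₀ (by positivity)] at hpow
  calc (1 + x) ^ c * Real.exp (-x / 2)
      ≤ (1 + x) ^ ⌈c⌉₊ * Real.exp (-x / 2) := by
        rw [← Real.rpow_natCast]
        gcongr
        exacts [by linarith, Nat.le_ceil c]
    _ ≤ Real.exp ((1 + x) / 2) * (2 ^ ⌈c⌉₊ * ⌈c⌉₊.factorial) * Real.exp (-x / 2) := by gcongr
    _ = ⌈c⌉₊.factorial * 2 ^ ⌈c⌉₊ * (Real.exp ((1 + x) / 2) * Real.exp (-x / 2)) := by ring
    _ = _ := by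
        rw [← Real.exp_add]
        ring_nf

variable [NormedSpace ℝ E] [FiniteDimensional ℝ E] [MeasurableSpace E] [BorelSpace E]
  (μ : Measure E) [μ.IsAddHaarMeasure]

theorem memLp_one_add_norm_rpow_mul_exp {p : ℝ≥0∞} (hp : p ≠ 0) (c : ℝ) :
    MemLp (fun z : E => (1 + ‖z‖) ^ c * Real.exp (-‖z‖ / 2)) p μ := by
  have hcont (b : ℝ) : Continuous fun z : E => (1 + ‖z‖) ^ b :=
    Continuous.rpow_const (by fun_prop) fun _ => .inl (by positivity)
  have hmeas : AEStronglyMeasurable (fun z : E => (1 + ‖z‖) ^ c * Real.exp (-‖z‖ / 2)) μ :=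
    ((hcont c).mul (by fun_prop)).aestronglyMeasurable
  rcases eq_or_ne p ∞ with rfl | hp_top
  · obtain ⟨B, hB⟩ := exists_one_add_rpow_mul_exp_le c
    refine memLp_top_of_bound hmeas B (.of_forall fun z => ?_)
    rw [Real.norm_of_nonneg (by positivity)]
    exact hB _ (norm_nonneg z)
  have hq : 0 < p.toReal := ENNReal.toReal_pos hp hp_top
  set b : ℝ := (Module.finrank ℝ E + 1) / p.toReal
  have hpow : MemLp (fun z : E => (1 + ‖z‖) ^ (-b)) p μ := by
    rw [← integrable_norm_rpow_iff (hcont _).aestronglyMeasurable hp hp_top]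
    have hint : Integrable (fun z : E => (1 + ‖z‖) ^ (-(Module.finrank ℝ E + 1 : ℝ))) μ :=
      integrable_one_add_norm (by simp)
    refine hint.congr (.of_forall fun z => ?_)
    dsimp only
    rw [Real.norm_of_nonneg (by positivity), ← Real.rpow_mul (by positivity), neg_mul,
      div_mul_cancel₀ _ hq.ne']
  obtain ⟨B, hB⟩ := exists_one_add_rpow_mul_exp_le (c + b)
  refine hpow.of_le_mul (c := B) hmeas (.of_forall fun z => ?_)
  rw [Real.norm_of_nonneg (by positivity), Real.norm_of_nonneg (by positivity),
    Real.rpow_neg (by positivity), ← div_eq_mul_inv, le_div_iff₀ (by positivity)]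
  refine (le_of_eq ?_).trans (hB _ (norm_nonneg z))
  rw [Real.rpow_add (by positivity)]
  ring

end GaussianWeight

section LocalBound

theorem lintegral_setLIntegral_ball {E : Type*} [NormedAddCommGroup E] [MeasurableSpace E]
    [BorelSpace E] [SecondCountableTopology E] (μ : Measure E) [SFinite μ]
    [μ.IsAddHaarMeasure] {g : E → ℝ≥0∞} (hg : Measurable g) (r : ℝ) :
    Measurable (fun z => ∫⁻ u in ball z r, g u ∂μ) ∧
      ∫⁻ z, ∫⁻ u in ball z r, g u ∂μ ∂μ = μ (ball 0 r) * ∫⁻ u, g u ∂μ := by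
  have hball : MeasurableSet {v : E × E | dist v.2 v.1 < r} :=
    (isOpen_lt (by fun_prop) continuous_const).measurableSet
  have hker : Measurable (Function.uncurry fun z u => (ball z r).indicator g u) :=
    (hg.comp measurable_snd).indicator hball
  have hindicator (z : E) : ∫⁻ u in ball z r, g u ∂μ = ∫⁻ u, (ball z r).indicator g u ∂μ :=
    (lintegral_indicator measurableSet_ball g).symm
  simp_rw [hindicator]
  refine ⟨hker.lintegral_prod_right', ?_⟩
  rw [lintegral_lintegral_swap hker.aemeasurable, ← lintegral_const_mul _ hg]
  refine lintegral_congr fun u => ?_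
  have hswap : (fun z => (ball z r).indicator g u) = (ball u r).indicator fun _ => g u := by
    ext z
    simp only [indicator, mem_ball, dist_comm]
  rw [hswap, lintegral_indicator_const measurableSet_ball, Measure.addHaar_ball_center, mul_comm]

theorem measurable_eLpNorm_restrict_ball {E : Type*} [NormedAddCommGroup E] [MeasurableSpace E]
    [BorelSpace E] [SecondCountableTopology E] (μ : Measure E) [SFinite μ]
    [μ.IsAddHaarMeasure] {ε : Type*} [ENorm ε] {g : E → ε} (hg : Measurable fun u => ‖g u‖ₑ)
    {p : ℝ≥0∞} (hp : p ≠ 0) (hp_top : p ≠ ∞) (r : ℝ) :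
    Measurable (fun z => eLpNorm g p (μ.restrict (ball z r))) ∧
      eLpNorm (fun z => eLpNorm g p (μ.restrict (ball z r))) p μ =
        μ (ball 0 r) ^ (1 / p.toReal) * eLpNorm g p μ := by
  have hq : 0 < p.toReal := ENNReal.toReal_pos hp hp_top
  obtain ⟨hmeas, hint⟩ := lintegral_setLIntegral_ball μ (hg.pow_const p.toReal) r
  simp only [eLpNorm_eq_lintegral_rpow_enorm_toReal hp hp_top]
  refine ⟨hmeas.pow_const _, ?_⟩
  simp only [enorm_eq_self, ← ENNReal.rpow_mul, one_div_mul_cancel hq.ne', ENNReal.rpow_one]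
  rw [hint, ENNReal.mul_rpow_of_nonneg _ _ (by positivity)]

variable {E : Type*} [NormedAddCommGroup E] [InnerProductSpace ℂ E]

theorem norm_mul_gaussWeight_mul_exp_inner_le (g : E → ℂ) (s : ℝ) {w u : E}
    (huw : ‖u - w‖ ≤ 1) :
    ‖g u * (gaussWeight s w * exp (-inner ℂ w (u - w)))‖ ≤
      2 ^ |s| * Real.exp (1 / 2) * gaussMod s g u := by
  have hsq : ‖u‖ ^ 2 = ‖w‖ ^ 2 + 2 * (inner ℂ w (u - w)).re + ‖u - w‖ ^ 2 := by
    have hadd := norm_add_sq (𝕜 := ℂ) w (u - w)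
    rwa [add_sub_cancel] at hadd
  have hexp : (‖u‖ ^ 2 - ‖w‖ ^ 2) / 2 + -(inner ℂ w (u - w)).re ≤ 1 / 2 := by
    nlinarith [norm_nonneg (u - w)]
  rw [norm_mul, norm_mul, norm_exp, neg_re, norm_real,
    Real.norm_of_nonneg (gaussWeight_pos s w).le]
  calc ‖g u‖ * (gaussWeight s w * Real.exp (-(inner ℂ w (u - w)).re))
      ≤ ‖g u‖ * (2 ^ |s| * Real.exp ((‖u‖ ^ 2 - ‖w‖ ^ 2) / 2) * gaussWeight s u *
          Real.exp (-(inner ℂ w (u - w)).re)) := by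
        gcongr
        exact gaussWeight_le_of_norm_sub_le_one (by rwa [norm_sub_rev]) s
    _ = 2 ^ |s| * Real.exp ((‖u‖ ^ 2 - ‖w‖ ^ 2) / 2 + -(inner ℂ w (u - w)).re) *
          gaussMod s g u := by
        rw [Real.exp_add, gaussMod]
        ring
    _ ≤ _ := by
        gcongr
        exact gaussMod_nonneg s g u

variable [FiniteDimensional ℂ E] [MeasurableSpace E] [BorelSpace E] (μ : Measure E)
  [μ.IsAddHaarMeasure] {p : ℝ≥0∞}

-- The entire factor `exp (-⟪w, u - w⟫)` has the size of the Gaussian quotient near `w`, so the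
-- sub-mean value property transfers to the weighted modulus.
theorem enorm_gaussMod_mul_measure_ball_rpow_le {g : E → ℂ} (hg : Differentiable ℂ g)
    (hp : p ≠ 0) (s : ℝ) (w : E) :
    ‖gaussMod s g w‖ₑ * μ (ball 0 1) ^ (1 / p.toReal) ≤
      ENNReal.ofReal (2 ^ |s| * Real.exp (1 / 2)) *
        eLpNorm (gaussMod s g) p (μ.restrict (ball w 1)) := by
  set F : E → ℂ := fun u => g u * (gaussWeight s w * exp (-inner ℂ w (u - w)))
  have hF : Differentiable ℂ F := by
    have hinner : Differentiable ℂ fun u : E => inner ℂ w (u - w) :=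
      (innerSL ℂ w).differentiable.comp (by fun_prop)
    exact hg.mul (hinner.neg.cexp.const_mul _)
  have hFw : ‖F w‖ₑ = ‖gaussMod s g w‖ₑ := by
    simp [F, gaussMod, ← ofReal_norm]
  rw [← hFw, ← Measure.addHaar_ball_center μ w]
  refine (enorm_mul_measure_ball_rpow_le_eLpNorm μ hF hp w one_pos).trans
    (eLpNorm_le_mul_eLpNorm_of_ae_le_mul ?_ p)
  refine (ae_restrict_iff' measurableSet_ball).2 (.of_forall fun u hu => ?_)
  rw [Real.norm_of_nonneg (gaussMod_nonneg s g u)]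
  exact norm_mul_gaussWeight_mul_exp_inner_le g s (mem_ball_iff_norm.1 hu).le

theorem exists_enorm_gaussMod_le_eLpNorm_ball (hp : p ≠ 0) (s : ℝ) :
    ∃ C : ℝ≥0, ∀ g : E → ℂ, Differentiable ℂ g → ∀ z, ∀ w ∈ closedBall z 1,
      ‖gaussMod s g w‖ₑ ≤ C * eLpNorm (gaussMod s g) p (μ.restrict (ball z 2)) := by
  have := FiniteDimensional.proper ℂ E
  set v : ℝ≥0∞ := μ (ball 0 1) ^ (1 / p.toReal)
  have hv : v ≠ 0 := (ENNReal.rpow_pos (measure_ball_pos μ 0 one_pos) measure_ball_lt_top.ne).ne'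
  have hv_top : v ≠ ∞ := ENNReal.rpow_ne_top_of_nonneg (by positivity) measure_ball_lt_top.ne
  set C : ℝ≥0∞ := ENNReal.ofReal (2 ^ |s| * Real.exp (1 / 2)) / v
  have hC_top : C ≠ ∞ := ENNReal.div_ne_top ENNReal.ofReal_ne_top hv
  refine ⟨C.toNNReal, fun g hg z w hw => ?_⟩
  rw [ENNReal.coe_toNNReal hC_top, ENNReal.mul_comm_div, ← mul_div_assoc,
    ENNReal.le_div_iff_mul_le (.inl hv) (.inl hv_top)]
  refine (enorm_gaussMod_mul_measure_ball_rpow_le μ hg hp s w).trans ?_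
  gcongr
  exact ball_subset_ball' (by linarith [mem_closedBall.1 hw])

theorem exists_enorm_local_majorant (hp : p ≠ 0) (s : ℝ) :
    ∃ C : ℝ≥0, ∀ g : E → ℂ, Differentiable ℂ g → ∃ M : E → ℝ≥0∞, Measurable M ∧
      (∀ z, ∀ w ∈ closedBall z 1, ‖gaussMod s g w‖ₑ ≤ M z) ∧
      (∀ z, M z ≤ C * eLpNorm (gaussMod s g) p μ) ∧
      eLpNorm M p μ ≤ C * eLpNorm (gaussMod s g) p μ := by
  have := FiniteDimensional.proper ℂ E
  obtain ⟨C, hC⟩ := exists_enorm_gaussMod_le_eLpNorm_ball μ hp s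
  have hrestrict (g : E → ℂ) (z : E) : eLpNorm (gaussMod s g) p (μ.restrict (ball z 2)) ≤
      eLpNorm (gaussMod s g) p μ := eLpNorm_mono_measure _ Measure.restrict_le_self
  rcases eq_or_ne p ∞ with rfl | hp_top
  · refine ⟨C, fun g hg => ⟨fun _ => C * eLpNorm (gaussMod s g) ∞ μ, measurable_const,
      fun z w hw => (hC g hg z w hw).trans (mul_le_mul_right (hrestrict g z) _),
      fun _ => le_rfl, ?_⟩⟩
    rw [eLpNorm_exponent_top (f := fun _ => _)]
    exact eLpNormEssSup_le_of_ae_enorm_bound (.of_forall fun _ => le_rfl)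
  set V : ℝ≥0 := (μ (ball 0 2) ^ (1 / p.toReal)).toNNReal
  have hV : (V : ℝ≥0∞) = μ (ball 0 2) ^ (1 / p.toReal) := ENNReal.coe_toNNReal
    (ENNReal.rpow_ne_top_of_nonneg (by positivity) measure_ball_lt_top.ne)
  refine ⟨C * (1 + V), fun g hg => ?_⟩
  obtain ⟨hmeas, hnorm⟩ := measurable_eLpNorm_restrict_ball μ
    (continuous_gaussMod s hg.continuous).measurable.enorm hp hp_top 2
  refine ⟨fun z => C * eLpNorm (gaussMod s g) p (μ.restrict (ball z 2)),
    hmeas.const_mul _, hC g hg, fun z => ?_, ?_⟩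
  · exact mul_le_mul' (mod_cast le_mul_of_one_le_right' le_self_add) (hrestrict g z)
  · refine (eLpNorm_le_mul_eLpNorm_of_ae_le_mul' (c := C)
      (g := fun z => eLpNorm (gaussMod s g) p (μ.restrict (ball z 2)))
      (.of_forall fun z => le_rfl) p).trans ?_
    rw [hnorm, ← hV, ← mul_assoc, ← ENNReal.coe_mul]
    exact mul_le_mul_left (mod_cast mul_le_mul_right le_add_self C) _

theorem exists_local_majorant (hp : p ≠ 0) (s : ℝ) :
    ∃ C : ℝ≥0, ∀ g : E → ℂ, Differentiable ℂ g → eLpNorm (gaussMod s g) p μ ≠ ∞ →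
      ∃ M : E → ℝ, Measurable M ∧ (∀ z, ∀ w ∈ closedBall z 1, gaussMod s g w ≤ M z) ∧
        (∀ z, M z ≤ (C * eLpNorm (gaussMod s g) p μ).toReal) ∧
        eLpNorm M p μ ≤ C * eLpNorm (gaussMod s g) p μ := by
  obtain ⟨C, hC⟩ := exists_enorm_local_majorant μ hp s
  refine ⟨C, fun g hg hfin => ?_⟩
  obtain ⟨M, hM, hloc, hunif, hnorm⟩ := hC g hg
  have hN : C * eLpNorm (gaussMod s g) p μ ≠ ∞ := ENNReal.mul_ne_top ENNReal.coe_ne_top hfin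
  have hM_top (z : E) : M z ≠ ∞ := ne_top_of_le_ne_top hN (hunif z)
  refine ⟨fun z => (M z).toReal, hM.ennreal_toReal, fun z w hw => ?_,
    fun z => ENNReal.toReal_mono hN (hunif z), (eLpNorm_mono_enorm fun z => ?_).trans hnorm⟩
  · have hw' := ENNReal.toReal_mono (hM_top z) (hloc z w hw)
    rwa [toReal_enorm, Real.norm_of_nonneg (gaussMod_nonneg s g w)] at hw'
  · rw [← ofReal_norm, Real.norm_of_nonneg ENNReal.toReal_nonneg,
      ENNReal.ofReal_toReal (hM_top z), enorm_eq_self]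

end LocalBound

section WeightedEstimate

variable {E F : Type*} [NormedAddCommGroup E] [NormedSpace ℂ E] [NormedAddCommGroup F]

-- Cauchy's estimate on the ball of radius `(1 + ‖z‖)⁻¹`, on which the Gaussian weight stays
-- comparable to its value at `z`.
theorem gaussMod_fderiv_le [NormedSpace ℂ F] {f : E → F} (hf : Differentiable ℂ f) {s M : ℝ}
    {z : E} (hM : ∀ w ∈ closedBall z 1, gaussMod (s + 1) f w ≤ M) :
    gaussMod s (fderiv ℂ f) z ≤ 2 ^ |s + 1| * Real.exp (3 / 2) * M := by
  have hz := norm_nonneg z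
  set r : ℝ := (1 + ‖z‖)⁻¹
  have hr : 0 < r := by positivity
  have hr_mul : r * (1 + ‖z‖) = 1 := inv_mul_cancel₀ (by positivity)
  have hr_one : r ≤ 1 := by nlinarith
  set W := gaussWeight (s + 1) z
  have hW : 0 < W := gaussWeight_pos _ _
  have hbound (w : E) (hw : w ∈ closedBall z r) :
      ‖f w‖ ≤ 2 ^ |s + 1| * Real.exp (3 / 2) * M / W := by
    have hzw : ‖z - w‖ ≤ r := mem_closedBall_iff_norm'.1 hw
    have hw_norm : ‖w‖ ≤ ‖z‖ + r := (norm_le_norm_add_norm_sub z w).trans (by gcongr)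
    have hsq : ‖w‖ ^ 2 - ‖z‖ ^ 2 ≤ 3 := by nlinarith [norm_nonneg w]
    rw [le_div_iff₀ hW]
    calc ‖f w‖ * W
        ≤ ‖f w‖ * (2 ^ |s + 1| * Real.exp ((‖w‖ ^ 2 - ‖z‖ ^ 2) / 2) * gaussWeight (s + 1) w) := by
          gcongr
          exact gaussWeight_le_of_norm_sub_le_one (hzw.trans hr_one) _
      _ = 2 ^ |s + 1| * Real.exp ((‖w‖ ^ 2 - ‖z‖ ^ 2) / 2) * gaussMod (s + 1) f w := by
          rw [gaussMod]
          ring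
      _ ≤ 2 ^ |s + 1| * Real.exp (3 / 2) * M := by
          gcongr
          exacts [gaussMod_nonneg _ _ _, hM w (closedBall_subset_closedBall hr_one hw)]
  have hcauchy := norm_fderiv_le_div hf hr hbound
  have hW_eq : W = gaussWeight s z / r := by
    rw [div_inv_eq_mul, ← Real.rpow_one (1 + ‖z‖), ← gaussWeight_add]
  rw [div_div, hW_eq, div_mul_cancel₀ _ hr.ne', le_div_iff₀ (gaussWeight_pos s z)] at hcauchy
  exact hcauchy

theorem norm_sub_smul_of_le_one {t : ℝ} (ht : t ≤ 1) (z : E) :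
    ‖z - (t : ℂ) • z‖ = (1 - t) * ‖z‖ := by
  have hsub : z - (t : ℂ) • z = ((1 - t : ℝ) : ℂ) • z := by
    push_cast
    rw [sub_smul, one_smul]
  rw [hsub, norm_smul, norm_real, Real.norm_of_nonneg (sub_nonneg.2 ht)]

theorem norm_sq_smul_sub_norm_sq_le {t : ℝ} (ht : t ∈ Icc (0 : ℝ) 1) (z : E) :
    ‖(t : ℂ) • z‖ ^ 2 - ‖z‖ ^ 2 ≤ -((1 - t) * ‖z‖ ^ 2) := by
  rw [norm_smul, norm_real, Real.norm_of_nonneg ht.1]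
  nlinarith [mul_nonneg (mul_nonneg ht.1 (sub_nonneg.2 ht.2)) (sq_nonneg ‖z‖)]

theorem gaussWeight_le_smul_of_le {t : ℝ} (ht : t ∈ Icc (0 : ℝ) 1) {z : E}
    (htz : (1 - t) * ‖z‖ ≤ 1) (s : ℝ) :
    gaussWeight s z ≤ 2 ^ |s| * Real.exp (1 / 2) *
      Real.exp (-((1 - t) * ((1 + ‖z‖ ^ 2) / 2))) * gaussWeight s ((t : ℂ) • z) := by
  rw [← norm_sub_smul_of_le_one ht.2] at htz
  refine (gaussWeight_le_of_norm_sub_le_one htz s).trans ?_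
  rw [mul_assoc (2 ^ |s|) (Real.exp (1 / 2)), ← Real.exp_add]
  have := gaussWeight_pos s ((t : ℂ) • z)
  gcongr
  linarith [norm_sq_smul_sub_norm_sq_le ht z, ht.1]

theorem gaussWeight_le_smul_of_lt {t : ℝ} (ht : t ∈ Icc (0 : ℝ) 1) {z : E}
    (htz : 1 < (1 - t) * ‖z‖) (s : ℝ) :
    gaussWeight s z ≤
      (1 + ‖z‖) ^ |s| * Real.exp (-‖z‖ / 2) * gaussWeight s ((t : ℂ) • z) := by
  have hnorm : ‖(t : ℂ) • z‖ ≤ ‖z‖ := by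
    rw [norm_smul, norm_real, Real.norm_of_nonneg ht.1]
    exact mul_le_of_le_one_left (norm_nonneg z) ht.2
  refine (gaussWeight_le_mul (w := (t : ℂ) • z) (c := 1 + ‖z‖) ?_ ?_ s).trans ?_
  · nlinarith [norm_nonneg z, norm_nonneg ((t : ℂ) • z)]
  · nlinarith [norm_nonneg z]
  · have := gaussWeight_pos s ((t : ℂ) • z)
    gcongr
    nlinarith [norm_sq_smul_sub_norm_sq_le ht z, norm_nonneg z]

-- Along the segment from `0` to `z` the Gaussian weight decays away from `z` at rate `‖z‖²`: near
-- `z` the local bound applies, and further out the global one suffices.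
theorem norm_smul_mul_gaussWeight_le {h : E → F} {s M K : ℝ} {z : E}
    (hM : ∀ w ∈ closedBall z 1, gaussMod s h w ≤ M) (hK : ∀ w, gaussMod s h w ≤ K)
    {t : ℝ} (ht : t ∈ Icc (0 : ℝ) 1) :
    ‖h ((t : ℂ) • z)‖ * gaussWeight s z ≤
      2 ^ |s| * Real.exp (1 / 2) * M * Real.exp (-((1 - t) * ((1 + ‖z‖ ^ 2) / 2))) +
        K * ((1 + ‖z‖) ^ |s| * Real.exp (-‖z‖ / 2)) := by
  have hM₀ : 0 ≤ M := (gaussMod_nonneg s h z).trans (hM z (mem_closedBall_self zero_le_one))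
  have hK₀ : 0 ≤ K := (gaussMod_nonneg s h z).trans (hK z)
  have hmul {c : ℝ} (hc : gaussWeight s z ≤ c * gaussWeight s ((t : ℂ) • z)) :
      ‖h ((t : ℂ) • z)‖ * gaussWeight s z ≤ c * gaussMod s h ((t : ℂ) • z) := by
    rw [gaussMod, mul_left_comm]
    exact mul_le_mul_of_nonneg_left hc (norm_nonneg _)
  rcases le_or_gt ((1 - t) * ‖z‖) 1 with htz | htz
  · have hmem : (t : ℂ) • z ∈ closedBall z 1 := by
      rwa [mem_closedBall_iff_norm', norm_sub_smul_of_le_one ht.2]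
    refine (hmul (gaussWeight_le_smul_of_le ht htz s)).trans
      (le_add_of_le_of_nonneg ?_ (by positivity))
    rw [mul_right_comm _ M]
    gcongr
    exact hM _ hmem
  · refine (hmul (gaussWeight_le_smul_of_lt ht htz s)).trans
      (le_add_of_nonneg_of_le (by positivity) ?_)
    rw [mul_comm K]
    gcongr
    exact hK _

theorem integral_exp_neg_one_sub_mul_le {b : ℝ} (hb : 0 < b) :
    ∫ t in (0 : ℝ)..1, Real.exp (-((1 - t) * b)) ≤ 1 / b := by
  have hderiv (t : ℝ) : HasDerivAt (fun t : ℝ => Real.exp (-((1 - t) * b)) / b)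
      (Real.exp (-((1 - t) * b))) t := by
    have hlin : HasDerivAt (fun t : ℝ => -((1 - t) * b)) b t :=
      (((hasDerivAt_id t).const_sub 1).mul_const b).neg.congr_deriv (by ring)
    exact (hlin.exp.div_const b).congr_deriv (mul_div_cancel_right₀ _ hb.ne')
  rw [intervalIntegral.integral_eq_sub_of_hasDerivAt (fun t _ => hderiv t)
    (Continuous.intervalIntegrable (by fun_prop) _ _)]
  simp only [sub_self, zero_mul, neg_zero, Real.exp_zero]
  exact sub_le_self _ (by positivity)

variable [NormedSpace ℂ F] {f : E → F}

theorem hasDerivAt_pow_smul_comp_ray (hf : Differentiable ℂ f) {a : ℕ} (ha : 0 < a) (z : E)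
    (t : ℝ) :
    HasDerivAt (fun t : ℝ => (t : ℂ) ^ a • f ((t : ℂ) • z))
      ((t : ℂ) ^ (a - 1) • eulerD a f ((t : ℂ) • z)) t := by
  have hray := hasDerivAt_comp_line hf 0 z t
  simp only [zero_add] at hray
  refine (((hasDerivAt_pow a (t : ℂ)).smul hray).scomp t ofRealCLM.hasDerivAt).congr_deriv ?_
  obtain ⟨b, rfl⟩ := Nat.exists_eq_add_of_le' ha
  simp only [Nat.add_sub_cancel, eulerD, map_smul, smul_add, smul_smul, pow_succ,
    ofRealCLM_apply, ofReal_one, mul_one, one_mul, ← Nat.cast_smul_eq_nsmul ℂ, mul_comm]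

variable [FiniteDimensional ℂ E] [CompleteSpace F]

theorem norm_le_integral_of_norm_eulerD_le (hf : Differentiable ℂ f) {a : ℕ} (ha : 0 < a) (z : E)
    {g : ℝ → ℝ} (hg : Continuous g)
    (hle : ∀ t ∈ Icc (0 : ℝ) 1, ‖eulerD a f ((t : ℂ) • z)‖ ≤ g t) :
    ‖f z‖ ≤ ∫ t in (0 : ℝ)..1, g t := by
  have hcont : Continuous fun t : ℝ => (t : ℂ) ^ (a - 1) • eulerD a f ((t : ℂ) • z) :=
    (by fun_prop : Continuous fun t : ℝ => (t : ℂ) ^ (a - 1)).smul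
      ((differentiable_eulerD hf a).continuous.comp (by fun_prop))
  have hftc := intervalIntegral.integral_eq_sub_of_hasDerivAt (a := 0) (b := 1)
    (fun t _ => hasDerivAt_pow_smul_comp_ray hf ha z t) (hcont.intervalIntegrable _ _)
  simp only [ofReal_one, one_pow, one_smul, ofReal_zero, zero_pow ha.ne', zero_smul,
    sub_zero] at hftc
  rw [← hftc]
  refine intervalIntegral.norm_integral_le_of_norm_le zero_le_one (.of_forall fun t ht => ?_)
    (hg.intervalIntegrable _ _)
  refine le_trans ?_ (hle t (Ioc_subset_Icc_self ht))
  rw [norm_smul, norm_pow, norm_real, Real.norm_of_nonneg ht.1.le]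
  exact mul_le_of_le_one_left (norm_nonneg _) (pow_le_one₀ ht.1.le ht.2)

theorem gaussMod_add_two_le_of_gaussMod_eulerD_le (hf : Differentiable ℂ f) {a : ℕ} (ha : 0 < a)
    {s M K : ℝ} {z : E} (hM : ∀ w ∈ closedBall z 1, gaussMod s (eulerD a f) w ≤ M)
    (hK : ∀ w, gaussMod s (eulerD a f) w ≤ K) :
    gaussMod (s + 2) f z ≤ 4 * (2 ^ |s| * Real.exp (1 / 2)) * M +
      K * ((1 + ‖z‖) ^ (|s| + 2) * Real.exp (-‖z‖ / 2)) := by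
  set A : ℝ := 2 ^ |s| * Real.exp (1 / 2)
  set D : ℝ := K * ((1 + ‖z‖) ^ |s| * Real.exp (-‖z‖ / 2)) with hD
  set b : ℝ := (1 + ‖z‖ ^ 2) / 2 with hb_def
  have hb : 0 < b := by positivity
  have hM₀ : 0 ≤ M := (gaussMod_nonneg s _ z).trans (hM z (mem_closedBall_self zero_le_one))
  have hW : 0 < gaussWeight s z := gaussWeight_pos s z
  have hgain : (1 + ‖z‖) ^ 2 * (1 / b) ≤ 4 := by
    rw [mul_one_div, div_le_iff₀ hb, hb_def]
    nlinarith [sq_nonneg (‖z‖ - 1)]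
  have hint : ‖f z‖ ≤ ∫ t in (0 : ℝ)..1,
      (A * M * Real.exp (-((1 - t) * b)) + D) / gaussWeight s z :=
    norm_le_integral_of_norm_eulerD_le hf ha z (by fun_prop) fun t ht =>
      (le_div_iff₀ hW).2 (norm_smul_mul_gaussWeight_le hM hK ht)
  rw [intervalIntegral.integral_div, le_div_iff₀ hW, intervalIntegral.integral_add
    (Continuous.intervalIntegrable (by fun_prop) _ _) (by simp),
    intervalIntegral.integral_const_mul, intervalIntegral.integral_const, sub_zero, one_smul]
    at hint
  calc gaussMod (s + 2) f z = (1 + ‖z‖) ^ 2 * (‖f z‖ * gaussWeight s z) := by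
        rw [gaussMod, gaussWeight_add, Real.rpow_two]
        ring
    _ ≤ (1 + ‖z‖) ^ 2 * (A * M * (1 / b) + D) := by
        gcongr
        refine hint.trans ?_
        gcongr
        exact integral_exp_neg_one_sub_mul_le hb
    _ = (1 + ‖z‖) ^ 2 * (1 / b) * (A * M) + (1 + ‖z‖) ^ 2 * D := by ring
    _ ≤ 4 * (A * M) + (1 + ‖z‖) ^ 2 * D := by gcongr
    _ = _ := by
        rw [hD, Real.rpow_add (by positivity), Real.rpow_two]
        ring

end WeightedEstimate

section NormEstimate

theorem eLpNorm_le_of_norm_le_mul_add_mul {X : Type*} [MeasurableSpace X] {μ : Measure X}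
    {p : ℝ≥0∞} {h M κ : X → ℝ} (hM : AEStronglyMeasurable M μ) (hκ : AEStronglyMeasurable κ μ)
    {A K : ℝ≥0} (hh : ∀ z, ‖h z‖ ≤ A * M z + K * κ z) :
    eLpNorm h p μ ≤ ENNReal.LpAddConst p * (A * eLpNorm M p μ + K * eLpNorm κ p μ) := by
  have hmul (c : ℝ≥0) (g : X → ℝ) : eLpNorm (fun z => c * g z) p μ ≤ c * eLpNorm g p μ :=
    eLpNorm_le_nnreal_smul_eLpNorm_of_ae_le_mul (.of_forall fun z => by simp [nnnorm_mul]) p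
  calc eLpNorm h p μ ≤ eLpNorm ((fun z => A * M z) + fun z => K * κ z) p μ :=
        eLpNorm_mono_real hh
    _ ≤ ENNReal.LpAddConst p *
          (eLpNorm (fun z => A * M z) p μ + eLpNorm (fun z => K * κ z) p μ) :=
        eLpNorm_add_le' (hM.const_mul _) (hκ.const_mul _) p
    _ ≤ _ := mul_le_mul_right (add_le_add (hmul A M) (hmul K κ)) _

variable {E : Type*} [NormedAddCommGroup E] [InnerProductSpace ℂ E] [FiniteDimensional ℂ E]
  [MeasurableSpace E] [BorelSpace E] (μ : Measure E) [μ.IsAddHaarMeasure] {p : ℝ≥0∞}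

theorem exists_eLpNorm_le_of_local_bound (hp : p ≠ 0) (s c : ℝ) (A : ℝ≥0) :
    ∃ C : ℝ≥0, ∀ g : E → ℂ, Differentiable ℂ g → ∀ h : E → ℝ,
      (∀ z M K, (∀ w ∈ closedBall z 1, gaussMod s g w ≤ M) → (∀ w, gaussMod s g w ≤ K) →
        ‖h z‖ ≤ A * M + K * ((1 + ‖z‖) ^ c * Real.exp (-‖z‖ / 2))) →
      eLpNorm h p μ ≤ C * eLpNorm (gaussMod s g) p μ := by
  have := FiniteDimensional.complete ℂ E
  let _ : NormedSpace ℝ E := NormedSpace.complexToReal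
  have := FiniteDimensional.complexToReal E
  obtain ⟨C, hC⟩ := exists_local_majorant μ hp s
  set κ : E → ℝ := fun z => (1 + ‖z‖) ^ c * Real.exp (-‖z‖ / 2)
  have hκ : MemLp κ p μ := memLp_one_add_norm_rpow_mul_exp μ hp c
  set T : ℝ≥0 := (ENNReal.LpAddConst p).toNNReal * (A * C + C * (eLpNorm κ p μ).toNNReal) + 1
  have hT : ENNReal.LpAddConst p * (A * C + C * eLpNorm κ p μ) ≤ T := by
    simp [T, ENNReal.coe_toNNReal (ENNReal.LpAddConst_lt_top p).ne,
      ENNReal.coe_toNNReal hκ.eLpNorm_ne_top]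
  refine ⟨T, fun g hg h hh => ?_⟩
  set N := eLpNorm (gaussMod s g) p μ
  rcases eq_or_ne N ∞ with hN | hN
  · rw [hN, ENNReal.mul_top (by simp [T])]
    exact le_top
  obtain ⟨M, hM_meas, hM, hM_le, hM_norm⟩ := hC g hg hN
  set K : ℝ≥0 := (C * N).toNNReal
  have hK : K = C * N := ENNReal.coe_toNNReal (ENNReal.mul_ne_top ENNReal.coe_ne_top hN)
  calc eLpNorm h p μ ≤ ENNReal.LpAddConst p * (A * eLpNorm M p μ + K * eLpNorm κ p μ) :=
        eLpNorm_le_of_norm_le_mul_add_mul hM_meas.aestronglyMeasurable hκ.1 fun z =>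
          hh z (M z) K (hM z) fun w => (hM w w (mem_closedBall_self zero_le_one)).trans (hM_le w)
    _ ≤ ENNReal.LpAddConst p * (A * (C * N) + C * N * eLpNorm κ p μ) := by
        rw [hK]
        exact mul_le_mul_right (add_le_add_left (mul_le_mul_right hM_norm _) _) _
    _ = ENNReal.LpAddConst p * (A * C + C * eLpNorm κ p μ) * N := by ring
    _ ≤ T * N := mul_le_mul_left hT N

theorem exists_eLpNorm_gaussMod_fderiv_le (hp : p ≠ 0) (s : ℝ) :
    ∃ C : ℝ≥0, ∀ f : E → ℂ, Differentiable ℂ f →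
      eLpNorm (gaussMod s (fderiv ℂ f)) p μ ≤ C * eLpNorm (gaussMod (s + 1) f) p μ := by
  obtain ⟨C, hC⟩ := exists_eLpNorm_le_of_local_bound (E := E) μ hp (s + 1) 0
    ⟨2 ^ |s + 1| * Real.exp (3 / 2), by positivity⟩
  refine ⟨C, fun f hf => hC f hf _ fun z M K hM hK => ?_⟩
  have hK₀ : 0 ≤ K := (gaussMod_nonneg _ f z).trans (hK z)
  rw [Real.norm_of_nonneg (gaussMod_nonneg _ _ _)]
  exact (gaussMod_fderiv_le hf hM).trans (le_add_of_nonneg_right (by positivity))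

theorem exists_eLpNorm_gaussMod_le_eulerD (hp : p ≠ 0) {a : ℕ} (ha : 0 < a) (s : ℝ) :
    ∃ C : ℝ≥0, ∀ f : E → ℂ, Differentiable ℂ f →
      eLpNorm (gaussMod (s + 2) f) p μ ≤ C * eLpNorm (gaussMod s (eulerD a f)) p μ := by
  obtain ⟨C, hC⟩ := exists_eLpNorm_le_of_local_bound (E := E) μ hp s (|s| + 2)
    ⟨4 * (2 ^ |s| * Real.exp (1 / 2)), by positivity⟩
  refine ⟨C, fun f hf => hC _ (differentiable_eulerD hf a) _ fun z M K hM hK => ?_⟩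
  rw [Real.norm_of_nonneg (gaussMod_nonneg _ _ _)]
  exact gaussMod_add_two_le_of_gaussMod_eulerD_le hf ha hM hK

theorem exists_eLpNorm_gaussMod_le_eulerPochhammer (hp : p ≠ 0) {a : ℕ} (ha : 0 < a) (s : ℝ)
    (m : ℕ) : ∃ C : ℝ≥0, ∀ f : E → ℂ, Differentiable ℂ f →
      eLpNorm (gaussMod (s + 2 * m) f) p μ ≤
        C * eLpNorm (gaussMod s (eulerPochhammer a m f)) p μ := by
  induction m with
  | zero => exact ⟨1, fun f _ => by simp [eulerPochhammer]⟩
  | succ m ih =>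
    obtain ⟨C, hC⟩ := ih
    obtain ⟨K, hK⟩ := exists_eLpNorm_gaussMod_le_eulerD μ hp (Nat.add_pos_left ha m) (s + 2 * m)
    refine ⟨K * C, fun f hf => ?_⟩
    have hexp : s + 2 * (m + 1 : ℕ) = s + 2 * m + 2 := by
      push_cast
      ring
    rw [hexp, ENNReal.coe_mul, mul_assoc]
    exact (hK f hf).trans (mul_le_mul_right (hC _ (differentiable_eulerD hf _)) _)

end NormEstimate

section EulerBound

variable {n : ℕ} {f : CSpace n → ℂ}

theorem exists_eLpNorm_gaussMod_multiD_le (μ : Measure (CSpace n)) [μ.IsAddHaarMeasure]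
    {p : ℝ≥0∞} (hp : p ≠ 0) (s : ℝ) (γ : Fin n → ℕ) :
    ∃ C : ℝ≥0, ∀ f : CSpace n → ℂ, Differentiable ℂ f →
      eLpNorm (gaussMod s (multiD γ f)) p μ ≤
        C * eLpNorm (gaussMod (s + (∑ j, γ j : ℕ)) f) p μ := by
  induction γ using multiIndex_induction generalizing s with
  | zero => exact ⟨1, fun f _ => by simp [multiD_zero]⟩
  | add_single γ j ih =>
    obtain ⟨C, hC⟩ := ih (s + 1)
    obtain ⟨K, hK⟩ := exists_eLpNorm_gaussMod_fderiv_le (E := CSpace n) μ hp s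
    refine ⟨K * C, fun f hf => ?_⟩
    have hdegree : ∑ i, (γ + Pi.single j 1 : Fin n → ℕ) i = ∑ i, γ i + 1 := by
      simp [Finset.sum_add_distrib]
    have hexp : s + (∑ i, γ i + 1 : ℕ) = s + 1 + (∑ i, γ i : ℕ) := by
      push_cast
      ring
    have hpartial : eLpNorm (gaussMod s (multiD (γ + Pi.single j 1) f)) p μ ≤
        eLpNorm (gaussMod s (fderiv ℂ (multiD γ f))) p μ := by
      refine eLpNorm_mono_real fun z => ?_
      rw [Real.norm_of_nonneg (gaussMod_nonneg _ _ _), ← partialD_multiD hf]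
      exact mul_le_mul_of_nonneg_right (norm_partialD_le _ j z) (gaussWeight_pos s z).le
    rw [hdegree, hexp, ENNReal.coe_mul, mul_assoc]
    exact hpartial.trans ((hK _ (differentiable_multiD hf γ)).trans
      (mul_le_mul_right (hC f hf) _))

theorem norm_eulerD_le (a : ℕ) (f : CSpace n → ℂ) (z : CSpace n) :
    ‖eulerD a f z‖ ≤ (a + 1) * (1 + ‖z‖) * (‖f z‖ + ∑ j, ‖partialD j f z‖) := by
  have hradial : ‖fderiv ℂ f z z‖ ≤ ‖z‖ * ∑ j, ‖partialD j f z‖ := by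
    rw [fderiv_eq_sum_partialD, Finset.mul_sum]
    refine norm_sum_le_of_le _ fun j _ => ?_
    rw [norm_mul]
    gcongr
    exact PiLp.norm_apply_le z j
  calc ‖eulerD a f z‖ ≤ ‖z‖ * ∑ j, ‖partialD j f z‖ + a * ‖f z‖ :=
        (norm_add_le _ _).trans (add_le_add hradial (norm_nsmul_le ..))
    _ ≤ (a + 1) * (1 + ‖z‖) * ∑ j, ‖partialD j f z‖ + (a + 1) * (1 + ‖z‖) * ‖f z‖ := by
        gcongr <;> nlinarith [norm_nonneg z, (Nat.cast_nonneg a : (0 : ℝ) ≤ a)]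
    _ = _ := by ring

theorem norm_multiD_eulerD_le (hf : Differentiable ℂ f) {a k : ℕ} {γ : Fin n → ℕ}
    (hγ : γ ∈ multiIndexLE n k) (z : CSpace n) :
    ‖multiD γ (eulerD a f) z‖ ≤
      (a + k + 1) * (1 + n) * (1 + ‖z‖) * ∑ δ ∈ multiIndexLE n (k + 1), ‖multiD δ f z‖ := by
  rw [mem_multiIndexLE] at hγ
  set S := ∑ δ ∈ multiIndexLE n (k + 1), ‖multiD δ f z‖
  have hle_sum (δ : Fin n → ℕ) (hδ : ∑ j, δ j ≤ k + 1) : ‖multiD δ f z‖ ≤ S :=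
    Finset.single_le_sum (f := fun δ => ‖multiD δ f z‖) (fun _ _ => norm_nonneg _)
      (mem_multiIndexLE.2 hδ)
  have hpartial : ∑ j, ‖partialD j (multiD γ f) z‖ ≤ n * S := by
    refine (Finset.sum_le_card_nsmul _ _ S fun j _ => ?_).trans (by simp)
    rw [partialD_multiD hf]
    exact hle_sum _ (by simpa [Finset.sum_add_distrib] using hγ)
  have hcoeff : ((a + ∑ j, γ j : ℕ) : ℝ) ≤ a + k := by exact_mod_cast Nat.add_le_add_left hγ a
  rw [multiD_eulerD hf]
  calc _ ≤ ((a + ∑ j, γ j : ℕ) + 1 : ℝ) * (1 + ‖z‖) *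
          (‖multiD γ f z‖ + ∑ j, ‖partialD j (multiD γ f) z‖) := norm_eulerD_le _ _ z
    _ ≤ (a + k + 1) * (1 + ‖z‖) * (S + n * S) := by
        gcongr
        exact hle_sum γ (hγ.trans k.le_succ)
    _ = _ := by ring

theorem exists_norm_eulerPochhammer_le (n a m : ℕ) : ∃ C : ℝ≥0, ∀ f : CSpace n → ℂ,
    Differentiable ℂ f → ∀ z, ‖eulerPochhammer a m f z‖ ≤
      C * (1 + ‖z‖) ^ m * ∑ γ ∈ multiIndexLE n m, ‖multiD γ f z‖ := by
  induction m with
  | zero =>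
    refine ⟨1, fun f _ z => ?_⟩
    have hsingleton : multiIndexLE n 0 = {0} := by
      ext γ
      simp [mem_multiIndexLE, funext_iff]
    simp [eulerPochhammer, hsingleton, multiD_zero]
  | succ m ih =>
    obtain ⟨C, hC⟩ := ih
    set B : ℝ≥0 := ((a + m : ℕ) + m + 1) * (1 + n)
    refine ⟨C * ((multiIndexLE n m).card * B), fun f hf z => ?_⟩
    set S := ∑ δ ∈ multiIndexLE n (m + 1), ‖multiD δ f z‖
    calc ‖eulerPochhammer a (m + 1) f z‖
        ≤ C * (1 + ‖z‖) ^ m * ∑ γ ∈ multiIndexLE n m, ‖multiD γ (eulerD (a + m) f) z‖ :=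
          hC _ (differentiable_eulerD hf _) z
      _ ≤ C * (1 + ‖z‖) ^ m * ((multiIndexLE n m).card • (B * (1 + ‖z‖) * S)) := by
          gcongr
          exact Finset.sum_le_card_nsmul _ _ _ fun γ hγ => norm_multiD_eulerD_le hf hγ z
      _ = _ := by
          rw [nsmul_eq_mul]
          push_cast
          ring

end EulerBound

/-! ### Comparison of the Fock-Sobolev norms -/

section Comparison

theorem exists_eLpNorm_finset_sum_le {X ι : Type*} [MeasurableSpace X] (μ : Measure X)
    (p : ℝ≥0∞) (s : Finset ι) :
    ∃ C : ℝ≥0, ∀ g : ι → X → ℝ, (∀ i, AEStronglyMeasurable (g i) μ) →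
      eLpNorm (fun x => ∑ i ∈ s, g i x) p μ ≤ C * ∑ i ∈ s, eLpNorm (g i) p μ := by
  classical
  induction s using Finset.induction_on with
  | empty => exact ⟨0, fun g _ => by simp⟩
  | insert j s hj ih =>
    obtain ⟨C, hC⟩ := ih
    refine ⟨(ENNReal.LpAddConst p).toNNReal * (1 + C), fun g hg => ?_⟩
    simp only [Finset.sum_insert hj]
    refine (eLpNorm_add_le' (hg j)
      (Finset.aestronglyMeasurable_fun_sum s fun i _ => hg i) p).trans ?_
    rw [ENNReal.coe_mul, ENNReal.coe_toNNReal (ENNReal.LpAddConst_lt_top p).ne, mul_assoc]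
    refine mul_le_mul_right ?_ _
    rw [ENNReal.coe_add, ENNReal.coe_one, add_mul, one_mul, mul_add]
    exact add_le_add le_self_add ((hC g hg).trans le_add_self)

instance isAddHaarMeasure_volV (n : ℕ) : (volV n).IsAddHaarMeasure :=
  .smul volume (ENNReal.ofReal_pos.2 (by positivity)).ne' ENNReal.ofReal_ne_top

/-- The exponent `s` for which the norm of `L^p_α` is the `L^p` norm against `gaussWeight s`. -/
def weightExp (p : ℝ≥0∞) (α : ℝ) : ℝ :=
  if p = ∞ then -α else -α / p.toReal

variable {n : ℕ} {f : CSpace n → ℂ}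

theorem weightedNorm_eq_eLpNorm {p : ℝ≥0∞} (hp : p ≠ 0) (α : ℝ) (ψ : CSpace n → ℂ) :
    weightedNorm p α ψ = eLpNorm (gaussMod (weightExp p α) ψ) p (volV n) := by
  have henorm (s : ℝ) (z : CSpace n) :
      ‖gaussMod s ψ z‖ₑ = ENNReal.ofReal (‖ψ z‖ * gaussWeight s z) :=
    Real.enorm_eq_ofReal (gaussMod_nonneg s ψ z)
  rcases eq_or_ne p ∞ with rfl | hp_top
  · rw [weightedNorm, if_pos rfl, weightExp, if_pos rfl, eLpNorm_exponent_top, eLpNormEssSup]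
    congr 1 with z
    rw [henorm, gaussWeight, ← mul_assoc, Real.rpow_neg (by positivity), div_eq_mul_inv]
  have hq : 0 < p.toReal := ENNReal.toReal_pos hp hp_top
  have hdensity : Measurable fun z : CSpace n => ENNReal.ofReal (1 / (1 + ‖z‖) ^ α) := by fun_prop
  rw [weightedNorm, if_neg hp_top, volW,
    lintegral_withDensity_eq_lintegral_mul_non_measurable _ hdensity (by simp),
    eLpNorm_eq_lintegral_rpow_enorm_toReal hp hp_top]
  congr 2 with z
  have hweight : ((1 + ‖z‖) ^ (-α / p.toReal)) ^ p.toReal = 1 / (1 + ‖z‖) ^ α := by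
    rw [← Real.rpow_mul (by positivity), div_mul_cancel₀ _ hq.ne', Real.rpow_neg (by positivity),
      one_div]
  rw [Pi.mul_apply, henorm, weightExp, if_neg hp_top, gaussWeight, ← mul_assoc,
    ENNReal.ofReal_mul (by positivity) (q := (1 + ‖z‖) ^ (-α / p.toReal)),
    ENNReal.mul_rpow_of_nonneg _ _ hq.le, mul_comm,
    ENNReal.ofReal_rpow_of_nonneg (x := (1 + ‖z‖) ^ _) (by positivity) hq.le, hweight]

theorem radialD_natCast (hn : 0 < n) (m : ℕ) (hf : Differentiable ℂ f) (z : CSpace n) :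
    radialD (m : ℝ) f z = (((1 + ‖z‖) ^ (-m : ℝ) : ℝ) : ℂ) * eulerPochhammer n m f z := by
  rw [radialD, fracD_natCast hn m hf]

theorem continuous_radialD_natCast (hn : 0 < n) (m : ℕ) (hf : Differentiable ℂ f) :
    Continuous (radialD (m : ℝ) f) := by
  rw [funext (radialD_natCast hn m hf)]
  exact (continuous_ofReal.comp (Continuous.rpow_const (by fun_prop) fun z =>
    .inl (by positivity))).mul (differentiable_eulerPochhammer hf n m).continuous

theorem gaussMod_radialD_natCast (hn : 0 < n) (m : ℕ) (s : ℝ) (hf : Differentiable ℂ f) :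
    gaussMod s (radialD (m : ℝ) f) = gaussMod (s - m) (eulerPochhammer n m f) := by
  ext z
  rw [gaussMod, gaussMod, radialD_natCast hn m hf, norm_mul, norm_real,
    Real.norm_of_nonneg (by positivity), sub_eq_add_neg, gaussWeight_add]
  ring

theorem exists_eLpNorm_gaussMod_radialD_le (hn : 0 < n) (μ : Measure (CSpace n)) (p : ℝ≥0∞)
    (m : ℕ) (s : ℝ) : ∃ C : ℝ≥0, ∀ f : CSpace n → ℂ, Differentiable ℂ f →
      eLpNorm (gaussMod s (radialD (m : ℝ) f)) p μ ≤
        C * ∑ γ ∈ multiIndexLE n m, eLpNorm (gaussMod s (multiD γ f)) p μ := by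
  obtain ⟨A, hA⟩ := exists_norm_eulerPochhammer_le n n m
  obtain ⟨C, hC⟩ := exists_eLpNorm_finset_sum_le μ p (multiIndexLE n m)
  refine ⟨A * C, fun f hf => ?_⟩
  have hpointwise (z : CSpace n) : ‖gaussMod s (radialD (m : ℝ) f) z‖ ≤
      A * ‖∑ γ ∈ multiIndexLE n m, gaussMod s (multiD γ f) z‖ := by
    rw [gaussMod_radialD_natCast hn m s hf, Real.norm_of_nonneg (gaussMod_nonneg _ _ _),
      Real.norm_of_nonneg (Finset.sum_nonneg fun γ _ => gaussMod_nonneg _ _ _)]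
    calc gaussMod (s - m) (eulerPochhammer n m f) z
        ≤ A * (1 + ‖z‖) ^ m * (∑ γ ∈ multiIndexLE n m, ‖multiD γ f z‖) *
            gaussWeight (s - m) z :=
          mul_le_mul_of_nonneg_right (hA f hf z) (gaussWeight_pos _ z).le
      _ = A * ((∑ γ ∈ multiIndexLE n m, ‖multiD γ f z‖) * gaussWeight (s - m + m) z) := by
          rw [gaussWeight_add, Real.rpow_natCast]
          ring
      _ = _ := by
          rw [sub_add_cancel, Finset.sum_mul]
          rfl
  rw [ENNReal.coe_mul, mul_assoc]
  exact (eLpNorm_le_nnreal_smul_eLpNorm_of_ae_le_mul (.of_forall hpointwise) p).trans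
    (mul_le_mul_right (hC _ fun γ =>
      (continuous_gaussMod s (differentiable_multiD hf γ).continuous).aestronglyMeasurable) _)

theorem exists_sum_eLpNorm_gaussMod_multiD_le (hn : 0 < n) (μ : Measure (CSpace n))
    [μ.IsAddHaarMeasure] {p : ℝ≥0∞} (hp : p ≠ 0) (m : ℕ) (s : ℝ) :
    ∃ C : ℝ≥0, ∀ f : CSpace n → ℂ, Differentiable ℂ f →
      ∑ γ ∈ multiIndexLE n m, eLpNorm (gaussMod s (multiD γ f)) p μ ≤
        C * eLpNorm (gaussMod s (radialD (m : ℝ) f)) p μ := by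
  choose C hC using exists_eLpNorm_gaussMod_multiD_le μ hp s
  obtain ⟨K, hK⟩ := exists_eLpNorm_gaussMod_le_eulerPochhammer (E := CSpace n) μ hp hn (s - m) m
  refine ⟨∑ γ ∈ multiIndexLE n m, C γ * K, fun f hf => ?_⟩
  rw [ENNReal.ofNNReal_finsetSum, Finset.sum_mul, gaussMod_radialD_natCast hn m s hf]
  refine Finset.sum_le_sum fun γ hγ => (hC γ f hf).trans ?_
  have hexp : s + (∑ j, γ j : ℕ) ≤ s - m + 2 * m := by
    have hdegree : ((∑ j, γ j : ℕ) : ℝ) ≤ m := by exact_mod_cast mem_multiIndexLE.1 hγ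
    linarith
  rw [ENNReal.coe_mul, mul_assoc]
  refine mul_le_mul_right ((eLpNorm_mono_real fun z => ?_).trans (hK f hf)) _
  rw [Real.norm_of_nonneg (gaussMod_nonneg _ _ _)]
  exact gaussMod_mono hexp f z

theorem exists_fockSobolevNorm_equiv (hn : 0 < n) {p : ℝ≥0∞} (hp : p ≠ 0) (α : ℝ) (m : ℕ) :
    ∃ C : ℝ≥0, 0 < C ∧ ∀ f : CSpace n → ℂ, Differentiable ℂ f →
      (C : ℝ≥0∞)⁻¹ * fockSobolevNorm p α (m : ℝ) f ≤
          ∑ γ ∈ multiIndexLE n m, weightedNorm p α (multiD γ f) ∧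
        ∑ γ ∈ multiIndexLE n m, weightedNorm p α (multiD γ f) ≤
          C * fockSobolevNorm p α (m : ℝ) f := by
  obtain ⟨A, hA⟩ := exists_eLpNorm_gaussMod_radialD_le hn (volV n) p m (weightExp p α)
  obtain ⟨B, hB⟩ := exists_sum_eLpNorm_gaussMod_multiD_le hn (volV n) hp m (weightExp p α)
  have hAC : (A : ℝ≥0∞) ≤ (A + (B + 1) : ℝ≥0) := mod_cast le_self_add
  have hBC : (B : ℝ≥0∞) ≤ (A + (B + 1) : ℝ≥0) := mod_cast le_self_add.trans le_add_self
  refine ⟨A + (B + 1), by positivity, fun f hf => ?_⟩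
  simp only [fockSobolevNorm, Nat.cast_nonneg, if_true, weightedNorm_eq_eLpNorm hp]
  rw [ENNReal.inv_mul_le_iff (by simp) ENNReal.coe_ne_top]
  exact ⟨(hA f hf).trans (mul_le_mul_left hAC _), (hB f hf).trans (mul_le_mul_left hBC _)⟩

theorem mem_fockSobolev_natCast_iff (hn : 0 < n) {p : ℝ≥0∞} {α : ℝ} {m : ℕ} :
    f ∈ fockSobolev n p α (m : ℝ) ↔
      Differentiable ℂ f ∧ fockSobolevNorm p α (m : ℝ) f < ∞ := by
  rw [fockSobolevNorm, if_pos m.cast_nonneg]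
  exact and_congr_right fun hf => and_iff_right
    (continuous_radialD_natCast hn m hf).aestronglyMeasurable

theorem sum_weightedNorm_multiD_lt_top_iff (hf : Differentiable ℂ f) {p : ℝ≥0∞} {α : ℝ} {m : ℕ} :
    ∑ γ ∈ multiIndexLE n m, weightedNorm p α (multiD γ f) < ∞ ↔
      ∀ γ : Fin n → ℕ, ∑ j, γ j ≤ m → MemL p α (multiD γ f) := by
  simp only [ENNReal.sum_lt_top, mem_multiIndexLE]
  exact forall₂_congr fun γ _ => (and_iff_right
    (differentiable_multiD hf γ).continuous.aestronglyMeasurable).symm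

end Comparison

end FockSobolev

end

theorem corollary4p4 (n : ℕ) (hn : 0 < n) (p : ℝ≥0∞) (hp : 0 < p) (α : ℝ)
    (m : ℕ) (hm : 0 < m) :
    (∃ C : ℝ≥0, 0 < C ∧ ∀ f : FockSobolev.CSpace n → ℂ, Differentiable ℂ f →
      (C : ℝ≥0∞)⁻¹ * FockSobolev.fockSobolevNorm p α (m : ℝ) f
          ≤ ∑ γ ∈ FockSobolev.multiIndexLE n m,
              FockSobolev.weightedNorm p α (FockSobolev.multiD γ f) ∧
      ∑ γ ∈ FockSobolev.multiIndexLE n m, FockSobolev.weightedNorm p α (FockSobolev.multiD γ f)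
          ≤ (C : ℝ≥0∞) * FockSobolev.fockSobolevNorm p α (m : ℝ) f) ∧
    FockSobolev.fockSobolev n p α (m : ℝ) =
      {f | Differentiable ℂ f ∧ ∀ γ : Fin n → ℕ, ∑ j, γ j ≤ m →
        FockSobolev.MemL p α (FockSobolev.multiD γ f)} := by
  obtain ⟨C, hC, hequiv⟩ := FockSobolev.exists_fockSobolevNorm_equiv hn hp.ne' α m
  refine ⟨⟨C, hC, hequiv⟩, Set.ext fun f => ?_⟩
  rw [FockSobolev.mem_fockSobolev_natCast_iff hn]
  refine and_congr_right fun hf => ?_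
  obtain ⟨hlower, hupper⟩ := hequiv f hf
  rw [← FockSobolev.sum_weightedNorm_multiD_lt_top_iff hf]
  rw [ENNReal.inv_mul_le_iff (by simpa using hC.ne') ENNReal.coe_ne_top] at hlower
  exact ⟨fun h => hupper.trans_lt (ENNReal.mul_lt_top ENNReal.coe_lt_top h),
    fun h => hlower.trans_lt (ENNReal.mul_lt_top ENNReal.coe_lt_top h)⟩
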